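/- Let $K$ be an algebraically closed field of characteristic zero, $q\ge 1$ an integer, and $0\ne f\in K(\!(x^{1/q})\!)$ with $\operatorname{ord}_x(f)=-p/q$, where $p\ge 0$ is an integer. Let $E_{f,q}=(V,\nabla)$ be the $K(\!(x)\!)$-connection given by $V=K(\!(x^{1/q})\!)$, regarded as a $K(\!(x)\!)$-vector space, and $\nabla(v)=\frac{dv}{dx}+x^{-1}fv$. Assume that $E_{f,q}$ is irreducible, i.e. $V$ has no proper nonzero $K(\!(x)\!)$-subspace stable under $\nabla$. Let $\zeta$ be a primitive $q$-th root of unity and let $$C_{f,q}(x,y)=\prod_{i=1}^{q}\Bigl(y-\frac{1}{f(\zeta^{i}x^{1/q})}\Bigr)\in K[\![x,y]\!]$$ be the associated curve germ. Then its Milnor number $\mu=\dim_K K[\![x,y]\!]/\bigl\langle \tfrac{\partial C_{f,q}}{\partial x},\tfrac{\partial C_{f,q}}{\partial y}\bigr\rangle$ is finite and $$\mu=(2p-1)(q-1)-\mathrm{Irr}\bigl(\mathrm{End}_{K(\!(x)\!)}(V)\bigr).$$ Here $\mathrm{End}_{K(\!(x)\!)}(V)$ carries the connection $\phi\mapsto\nabla\circ\phi-\phi\circ\nabla$.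 The irregularity of a $K(\!(x)\!)$-connection $M$ is defined by means of a Hukuhara–Turrittin–Levelt decomposition $M\cong\bigoplus_i E_{f_i,q_i}\otimes J_{m_i}$ as $\mathrm{Irr}(M)=\sum_i m_i\max\bigl(0,-q_i\operatorname{ord}_x(f_i)\bigr)$ (with summand $0$ if $f_i=0$), where $J_m=(K(\!(x)\!)^{m},\frac{d}{dx}+x^{-1}N_m)$ with $N_m$ the nilpotent Jordan block of size $m$, and where, for each $i$ and each $0<r<q_i$, the class of $f_i$ modulo $x^{1/q_i}K[\![x^{1/q_i}]\!]+\frac{1}{q_i}\mathbb{Z}$ has no representative in $K(\!(x^{1/r})\!)$. It is part of the assertion that $\mathrm{End}_{K(\!(x)\!)}(V)$ has such a decomposition and that the number so obtained does not depend on the decomposition. -/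

import Mathlib

open scoped TensorProduct

noncomputable section

namespace FormalConnection

/-! ### Derivations of `K((x))` and `K((x^{1/q}))` -/

section Leibniz

variable {K : Type*} [Field K]

theorem derivative_coeff (f : LaurentSeries K) (n : ℤ) :
    (LaurentSeries.derivative K f).coeff n = ((n + 1 : ℤ) : K) * f.coeff (n + 1) := by
  simp [LaurentSeries.derivative_apply, zsmul_eq_mul]

theorem derivative_mul (f g : LaurentSeries K) :
    LaurentSeries.derivative K (f * g) =
      f * LaurentSeries.derivative K g + LaurentSeries.derivative K f * g := by
  have key : ∀ h : LaurentSeries K, ∃ e : LaurentSeries K,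
      (∀ n, e.coeff n = (n : K) * h.coeff n) ∧
        LaurentSeries.derivative K h = HahnSeries.single (-1 : ℤ) (1 : K) * e := by
    intro h
    refine ⟨HahnSeries.single (1 : ℤ) (1 : K) * LaurentSeries.derivative K h, ?_, ?_⟩
    · intro n
      have := HahnSeries.coeff_single_mul_add (r := (1 : K))
        (x := LaurentSeries.derivative K h) (a := n - 1) (b := 1)
      rw [sub_add_cancel] at this
      rw [this, derivative_coeff, sub_add_cancel, one_mul]
    · rw [← mul_assoc, HahnSeries.single_mul_single]
      simp
  obtain ⟨ef, hef, hf⟩ := key f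
  obtain ⟨eg, heg, hg⟩ := key g
  obtain ⟨efg, hefg, hfg⟩ := key (f * g)
  have hsub : ∀ {e h : LaurentSeries K}, (∀ n : ℤ, e.coeff n = (n : K) * h.coeff n) →
      e.support ⊆ h.support := by
    intro e h he n hn hn'
    exact hn (by rw [he, hn', mul_zero])
  have hsum : efg = f * eg + ef * g := by
    ext n
    rw [hefg, HahnSeries.coeff_add, HahnSeries.coeff_mul,
      HahnSeries.coeff_mul_right' g.isPWO_support (hsub heg),
      HahnSeries.coeff_mul_left' f.isPWO_support (hsub hef), Finset.mul_sum,
      ← Finset.sum_add_distrib]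
    refine Finset.sum_congr rfl fun ij hij => ?_
    rw [Finset.mem_antidiagonal] at hij
    rw [hef, heg, ← hij.2.2]
    push_cast
    ring
  rw [hfg, hf, hg, hsum]
  ring

end Leibniz

/-- The field `K((x^{1/q}))`: its elements are Laurent series in the variable `t = x^{1/q}`. It is
kept apart from `LaurentSeries K`, which stands for `K((x))`, in order to be a vector space
over the latter through `x ↦ t^q`. -/
def Ram (K : Type*) [Field K] (_q : ℕ+) : Type _ := LaurentSeries K

section Ram

variable {K : Type*} [Field K] (q : ℕ+)

instance : Field (Ram K q) := inferInstanceAs (Field (LaurentSeries K))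

/-- A Laurent series in `t`, seen as an element of `K((x^{1/q}))`, `t = x^{1/q}`. -/
def toRam : LaurentSeries K ≃+* Ram K q := RingEquiv.refl (LaurentSeries K)

/-- The inclusion `K((x)) → K((t))`, `x ↦ t^q`. -/
def ramHom : LaurentSeries K →+* LaurentSeries K :=
  HahnSeries.embDomainRingHom (AddMonoidHom.mulLeft (q : ℤ))
    (fun a b h => by
      have hq : (q : ℤ) ≠ 0 := by exact_mod_cast q.ne_zero
      exact mul_left_cancel₀ hq h)
    (fun a b => by
      have hq : (0 : ℤ) < (q : ℤ) := by exact_mod_cast q.pos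
      exact mul_le_mul_iff_right₀ hq)

instance : Algebra (LaurentSeries K) (Ram K q) :=
  ((toRam q).toRingHom.comp (ramHom q)).toAlgebra

theorem ramHom_coeff_mul (a : LaurentSeries K) (n : ℤ) :
    (ramHom q a).coeff ((q : ℤ) * n) = a.coeff n :=
  HahnSeries.embDomain_coeff (f := ⟨⟨fun n : ℤ => (q : ℤ) * n, _⟩, _⟩)

theorem ramHom_coeff_of_not_dvd (a : LaurentSeries K) (n : ℤ) (hn : ¬ (q : ℤ) ∣ n) :
    (ramHom q a).coeff n = 0 := by
  refine HahnSeries.embDomain_of_notMem_range ?_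
  rintro ⟨m, rfl⟩
  exact hn ⟨m, rfl⟩

/-- The derivation `d/dx = (q t^{q-1})⁻¹ d/dt` of `K((x^{1/q}))`. -/
def ddx : LaurentSeries K →+ LaurentSeries K :=
  (AddMonoidHom.mulLeft (HahnSeries.single (1 - (q : ℤ)) ((q : K)⁻¹))).comp
    (LaurentSeries.derivative K).toAddMonoidHom

theorem ddx_apply (v : LaurentSeries K) :
    ddx q v = HahnSeries.single (1 - (q : ℤ)) ((q : K)⁻¹) * LaurentSeries.derivative K v := rfl

theorem ddx_coeff (v : LaurentSeries K) (n : ℤ) :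
    (ddx q v).coeff n = (q : K)⁻¹ * (((n + q : ℤ) : K) * v.coeff (n + q)) := by
  have := HahnSeries.coeff_single_mul_add (r := (q : K)⁻¹)
    (x := LaurentSeries.derivative K v) (a := n - (1 - (q : ℤ))) (b := 1 - (q : ℤ))
  rw [sub_add_cancel] at this
  rw [ddx_apply, this, derivative_coeff]
  congr 3 <;> ring_nf

theorem ddx_mul (a b : LaurentSeries K) : ddx q (a * b) = a * ddx q b + ddx q a * b := by
  simp only [ddx_apply, derivative_mul]
  ring

theorem ddx_ramHom [CharZero K] (a : LaurentSeries K) :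
    ddx q (ramHom q a) = ramHom q (LaurentSeries.derivative K a) := by
  have hq : (q : K) ≠ 0 := by exact_mod_cast q.ne_zero
  ext n
  rw [ddx_coeff]
  by_cases hn : (q : ℤ) ∣ n
  · obtain ⟨m, rfl⟩ := hn
    rw [ramHom_coeff_mul, derivative_coeff, show (q : ℤ) * m + q = q * (m + 1) by ring,
      ramHom_coeff_mul]
    push_cast
    field_simp
  · rw [ramHom_coeff_of_not_dvd q _ n hn, ramHom_coeff_of_not_dvd, mul_zero, mul_zero]
    simpa using hn

theorem Ram.smul_eq (a : LaurentSeries K) (v : Ram K q) :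
    a • v = toRam q (ramHom q a * (toRam q).symm v) := rfl

end Ram

/-! ### Connections -/

section Connections

variable {K : Type*} [Field K]

/-- A connection on a `K((x))`-vector space: an additive map satisfying the Leibniz rule.
It is automatically `K`-linear, since constants have derivative zero. -/
structure Connection (K : Type*) [Field K] (V : Type*) [AddCommGroup V]
    [Module (LaurentSeries K) V] where
  nabla : V →+ V
  leibniz : ∀ (a : LaurentSeries K) (v : V),
    nabla (a • v) = a • nabla v + LaurentSeries.derivative K a • v

variable {V W : Type*} [AddCommGroup V] [Module (LaurentSeries K) V]
  [AddCommGroup W] [Module (LaurentSeries K) W]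

namespace Connection

/-- Irreducibility: no proper nontrivial subspace is stable under the connection. -/
def IsIrreducible (D : Connection K V) : Prop :=
  Nontrivial V ∧ ∀ U : Submodule (LaurentSeries K) V,
    (∀ u ∈ U, D.nabla u ∈ U) → U = ⊥ ∨ U = ⊤

/-- Isomorphism of connections. -/
def Iso (D : Connection K V) (D' : Connection K W) : Prop :=
  ∃ e : V ≃ₗ[LaurentSeries K] W, ∀ v, e (D.nabla v) = D'.nabla (e v)

/-- The connection `φ ↦ ∇' ∘ φ - φ ∘ ∇` on the space of linear maps. -/
def hom (D : Connection K V) (D' : Connection K W) :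
    Connection K (V →ₗ[LaurentSeries K] W) where
  nabla :=
    { toFun := fun φ =>
        { toFun := fun v => D'.nabla (φ v) - φ (D.nabla v)
          map_add' := fun v w => by simp only [map_add]; abel
          map_smul' := fun a v => by
            simp only [map_smul, map_add, D.leibniz, D'.leibniz, RingHom.id_apply, smul_sub]
            abel }
      map_zero' := by ext; simp
      map_add' := fun φ ψ => by
        ext v
        simp only [LinearMap.add_apply, map_add, LinearMap.coe_mk, AddHom.coe_mk]
        abel }
  leibniz := fun a φ => by
    ext v
    simp only [AddMonoidHom.coe_mk, ZeroHom.coe_mk, LinearMap.coe_mk, AddHom.coe_mk,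
      LinearMap.smul_apply, LinearMap.add_apply, D'.leibniz, smul_sub]
    abel

/-- The tensor product connection `∇ ⊗ 1 + 1 ⊗ ∇'`. -/
def tensor (D : Connection K V) (D' : Connection K W) :
    Connection K (V ⊗[LaurentSeries K] W) where
  nabla := TensorProduct.liftAddHom
    { toFun := fun v =>
        { toFun := fun w => D.nabla v ⊗ₜ w + v ⊗ₜ D'.nabla w
          map_zero' := by simp
          map_add' := fun w w' => by simp only [map_add, TensorProduct.tmul_add]; abel }
      map_zero' := by ext; simp
      map_add' := fun v v' => by
        ext w
        simp only [map_add, TensorProduct.add_tmul, AddMonoidHom.coe_mk, ZeroHom.coe_mk,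
          AddMonoidHom.add_apply]
        abel }
    (fun a v w => by
      simp only [AddMonoidHom.coe_mk, ZeroHom.coe_mk, D.leibniz, D'.leibniz,
        TensorProduct.add_tmul, TensorProduct.tmul_add, TensorProduct.smul_tmul]
      abel)
  leibniz := fun a u => by
    induction u using TensorProduct.induction_on with
    | zero => simp
    | tmul v w =>
      simp only [TensorProduct.smul_tmul', TensorProduct.liftAddHom_tmul, AddMonoidHom.coe_mk,
        ZeroHom.coe_mk, D.leibniz, TensorProduct.add_tmul, smul_add]
      abel
    | add u u' hu hu' =>
      simp only [smul_add, map_add, hu, hu']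
      abel

/-- The direct sum of a finite family of connections. -/
def directSum {r : ℕ} {M : Fin r → Type*} [∀ i, AddCommGroup (M i)]
    [∀ i, Module (LaurentSeries K) (M i)] (D : ∀ i, Connection K (M i)) :
    Connection K (∀ i, M i) where
  nabla :=
    { toFun := fun v i => (D i).nabla (v i)
      map_zero' := by ext; simp
      map_add' := fun v w => by ext; simp }
  leibniz := fun a v => by
    ext i
    simp [(D i).leibniz]

end Connection

/-- The connection `E_{f,q}`: on `V = K((x^{1/q}))`, with `∇ v = dv/dx + x⁻¹ f v`.
The series `f` is written in `t = x^{1/q}`, so that `x⁻¹ = t^{-q}`. -/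
def connE [CharZero K] (q : ℕ+) (f : LaurentSeries K) : Connection K (Ram K q) where
  nabla := (toRam q).toAddMonoidHom.comp
    ((ddx q + AddMonoidHom.mulLeft (HahnSeries.single (-(q : ℤ)) (1 : K) * f)).comp
      (toRam q).symm.toAddMonoidHom)
  leibniz := fun a v => by
    change toRam q (ddx q (ramHom q a * (toRam q).symm v) +
        HahnSeries.single (-(q : ℤ)) (1 : K) * f * (ramHom q a * (toRam q).symm v)) =
      toRam q (ramHom q a * (ddx q ((toRam q).symm v) +
        HahnSeries.single (-(q : ℤ)) (1 : K) * f * (toRam q).symm v)) +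
      toRam q (ramHom q (LaurentSeries.derivative K a) * (toRam q).symm v)
    rw [← map_add, ddx_mul, ddx_ramHom]
    congr 1
    ring

/-- The connection `J_m = (K((x))^m, d/dx + x⁻¹ N_m)`, `N_m` the nilpotent Jordan block of
size `m` with ones above the diagonal. -/
def connJ (K : Type*) [Field K] (m : ℕ) : Connection K (Fin m → LaurentSeries K) where
  nabla :=
    (LaurentSeries.derivative K).toAddMonoidHom.compLeft (Fin m) +
      (HahnSeries.single (-1 : ℤ) (1 : K) •
        Matrix.toLin' (Matrix.of fun i j : Fin m =>
          if (i : ℕ) + 1 = j then (1 : LaurentSeries K) else 0)).toAddMonoidHom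
  leibniz := fun a v => by
    ext1 i
    simp only [AddMonoidHom.add_apply, LinearMap.toAddMonoidHom_coe, map_smul, Pi.add_apply,
      Pi.smul_apply, AddMonoidHom.compLeft_apply, Function.comp_apply, smul_eq_mul,
      derivative_mul]
    ring

/-! ### The irregularity -/

/-- `f ∈ K((x^{1/q}))` lies in `K((x^{1/r}))`: its exponents `n/q` all belong to `(1/r) ℤ`. -/
def LiesIn (q : ℕ+) (r : ℕ) (f : LaurentSeries K) : Prop :=
  ∀ n : ℤ, f.coeff n ≠ 0 → (q : ℤ) ∣ n * r

/-- `f` and `g` have the same class in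
`R_q(x) = K((x^{1/q})) / (x^{1/q} K[[x^{1/q}]] + (1/q) ℤ)`. -/
def SameClass (q : ℕ+) (f g : LaurentSeries K) : Prop :=
  ∃ k : ℤ, ∀ n : ℤ, n ≤ 0 → (f - g - HahnSeries.C ((k : K) / (q : K))).coeff n = 0

/-- The class of `f` in `R_q(x)` belongs to `R_q^o(x)`: it is not represented by an element of
`K((x^{1/r}))` for any `0 < r < q`. -/
def IsMinimallyRamified (q : ℕ+) (f : LaurentSeries K) : Prop :=
  ∀ r : ℕ, 0 < r → r < q → ¬ ∃ g : LaurentSeries K, LiesIn q r g ∧ SameClass q f g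

/-- The pole order in `t = x^{1/q}` of `f ∈ K((x^{1/q}))`, that is, `max (0, -q · ord_x f)`;
it is `0` for `f = 0`. -/
def poleOrder (f : LaurentSeries K) : ℕ := (-f.order).toNat

/-- `Irr (V, ∇) = n`: there is a Hukuhara-Turrittin-Levelt decomposition
`(V, ∇) ≅ ⨁ᵢ E_{fᵢ,qᵢ} ⊗ J_{mᵢ}` with `fᵢ ∈ R_{qᵢ}^o(x)`, and `n = ∑ᵢ mᵢ · max (0, -qᵢ ord_x fᵢ)`,
i.e. each of the `mᵢ qᵢ` exponential factors (conjugates of `fᵢ`, with multiplicity)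
contributes its pole order in `x`. -/
def HasIrregularity [CharZero K] (D : Connection K V) (n : ℕ) : Prop :=
  ∃ (r : ℕ) (q m : Fin r → ℕ+) (f : Fin r → LaurentSeries K),
    (∀ i, IsMinimallyRamified (q i) (f i)) ∧
    D.Iso (Connection.directSum fun i => (connE (q i) (f i)).tensor (connJ K (m i))) ∧
    n = ∑ i, (m i : ℕ) * poleOrder (f i)

end Connections

/-! ### Plane curve germs -/

section Curves

variable {K : Type*} [Field K]

/-- The quotient `K[[x,y]] / ⟨g, h⟩`. -/
abbrev IntersectionAlgebra (g h : MvPowerSeries (Fin 2) K) : Type _ :=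
  MvPowerSeries (Fin 2) K ⧸ Ideal.span {g, h}

/-- The intersection number `I(g, h) = dim_K K[[x,y]] / ⟨g, h⟩` (meaningful when this dimension
is finite). -/
def intersectionNumber (g h : MvPowerSeries (Fin 2) K) : ℕ :=
  Module.finrank K (IntersectionAlgebra g h)

/-- `∂C/∂x`, the variables being `x = X 0`, `y = X 1`. -/
abbrev partialX (C : MvPowerSeries (Fin 2) K) : MvPowerSeries (Fin 2) K :=
  MvPowerSeries.pderiv K 0 C

/-- `∂C/∂y`. -/
abbrev partialY (C : MvPowerSeries (Fin 2) K) : MvPowerSeries (Fin 2) K :=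
  MvPowerSeries.pderiv K 1 C

/-- The Milnor number `μ = I(∂C/∂x, ∂C/∂y)`. -/
def milnorNumber (C : MvPowerSeries (Fin 2) K) : ℕ :=
  intersectionNumber (partialX C) (partialY C)

/-- The series `f(c t)`. -/
def dilate (c : K) (f : LaurentSeries K) : LaurentSeries K where
  coeff n := c ^ n * f.coeff n
  isPWO_support' := f.isPWO_support.mono fun n hn hn' => hn (by simp only [hn', mul_zero])

/-- The product `∏_{i=1}^{q} (y - 1 / f(ζ^i x^{1/q}))`, a polynomial in `y` over
`K((t))`, `t = x^{1/q}`. -/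
def curvePolynomial (q : ℕ+) (ζ : K) (f : LaurentSeries K) : Polynomial (LaurentSeries K) :=
  ∏ i ∈ Finset.Icc 1 (q : ℕ), (Polynomial.X - Polynomial.C (dilate (ζ ^ i) f)⁻¹)

theorem dilate_mul {c : K} (hc : c ≠ 0) (f g : LaurentSeries K) :
    dilate c (f * g) = dilate c f * dilate c g := by
  have hsub : ∀ h : LaurentSeries K, (dilate c h).support ⊆ h.support := by
    intro h n hn hn'
    exact hn (by simp only [dilate, hn', mul_zero])
  ext n
  rw [HahnSeries.coeff_mul_left' f.isPWO_support (hsub f)]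
  have hsum : ∀ s ∈ Finset.antidiagonal f.isPWO_support (dilate c g).isPWO_support n,
      (dilate c f).coeff s.1 * (dilate c g).coeff s.2 = c ^ n * (f.coeff s.1 * g.coeff s.2) := by
    intro s hs
    rw [Finset.mem_antidiagonal] at hs
    simp only [dilate, ← hs.2.2, zpow_add₀ hc]
    ring
  rw [Finset.sum_congr rfl hsum, ← Finset.mul_sum]
  change c ^ n * (f * g).coeff n = _
  have hsupp : g.support ⊆ (dilate c g).support := by
    intro n hn hn'
    exact hn ((mul_eq_zero.mp hn').resolve_left (zpow_ne_zero n hc))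
  rw [HahnSeries.coeff_mul_right' (dilate c g).isPWO_support hsupp]

/-- The substitution `t ↦ c t` as a ring homomorphism. -/
def dilateHom (c : K) (hc : c ≠ 0) : LaurentSeries K →+* LaurentSeries K where
  toFun := dilate c
  map_zero' := by ext n; simp [dilate]
  map_one' := by
    ext n
    by_cases hn : n = 0
    · simp [dilate, hn]
    · simp [dilate, HahnSeries.coeff_one, hn]
  map_add' f g := by ext n; simp [dilate, mul_add]
  map_mul' := dilate_mul hc

theorem dilate_dilate (c d : K) (f : LaurentSeries K) :
    dilate c (dilate d f) = dilate (c * d) f := by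
  ext n
  simp [dilate, mul_zpow, mul_assoc]

theorem curvePolynomial_coeff (q : ℕ+) (ζ : K) (hζ : IsPrimitiveRoot ζ (q : ℕ))
    (f : LaurentSeries K) (hf : f ≠ 0) (hord : f.order ≤ 0) (b : ℕ) (n : ℤ)
    (hn : ((curvePolynomial q ζ f).coeff b).coeff n ≠ 0) : 0 ≤ n ∧ (q : ℤ) ∣ n := by
  have hζ0 : ζ ≠ 0 := hζ.ne_zero q.ne_zero
  constructor
  · have hlift : ∀ i : ℕ, ∃ g : PowerSeries K,
        HahnSeries.ofPowerSeries ℤ K g = (dilate (ζ ^ i) f)⁻¹ := by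
      intro i
      have hi : ζ ^ i ≠ 0 := pow_ne_zero i hζ0
      have hne : dilate (ζ ^ i) f ≠ 0 := (map_ne_zero (dilateHom (ζ ^ i) hi)).mpr hf
      have hle : (dilate (ζ ^ i) f).order ≤ 0 := by
        refine le_trans (HahnSeries.order_le_of_coeff_ne_zero (g := f.order) ?_) hord
        exact mul_ne_zero (zpow_ne_zero _ hi) ((by simpa using hf : f.coeff f.order ≠ 0))
      have hinv : 0 ≤ ((dilate (ζ ^ i) f)⁻¹).order := by
        have h1 := HahnSeries.order_mul hne (inv_ne_zero hne)
        rw [mul_inv_cancel₀ hne, HahnSeries.order_one] at h1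
        omega
      obtain ⟨k, hk⟩ := Int.eq_ofNat_of_zero_le hinv
      refine ⟨PowerSeries.X ^ k * LaurentSeries.powerSeriesPart (dilate (ζ ^ i) f)⁻¹, ?_⟩
      rw [map_mul, HahnSeries.ofPowerSeries_X_pow]
      have := LaurentSeries.single_order_mul_powerSeriesPart (dilate (ζ ^ i) f)⁻¹
      rwa [hk] at this
    choose g hg using hlift
    have hprod : curvePolynomial q ζ f =
        (∏ i ∈ Finset.Icc 1 (q : ℕ), (Polynomial.X - Polynomial.C (g i))).map
          (HahnSeries.ofPowerSeries ℤ K) := by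
      simp [curvePolynomial, Polynomial.map_prod, hg]
    by_contra hneg
    apply hn
    rw [hprod, Polynomial.coeff_map]
    exact (PowerSeries.coeff_coe _ _).trans (if_pos (not_le.mp hneg))
  · have hmap : (curvePolynomial q ζ f).map (dilateHom ζ hζ0) = curvePolynomial q ζ f := by
      have h1 : ∀ i : ℕ, dilateHom ζ hζ0 (dilate (ζ ^ i) f)⁻¹ = (dilate (ζ ^ (i + 1)) f)⁻¹ := by
        intro i
        rw [map_inv₀, pow_succ']
        exact congrArg _ (dilate_dilate _ _ _)
      simp only [curvePolynomial, Polynomial.map_prod, Polynomial.map_sub, Polynomial.map_X,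
        Polynomial.map_C, h1]
      have h2 := Finset.prod_range_succ' (fun i : ℕ =>
        (Polynomial.X - Polynomial.C (dilate (ζ ^ i) f)⁻¹ : Polynomial (LaurentSeries K))) q
      have h3 := Finset.prod_range_succ (fun i : ℕ =>
        (Polynomial.X - Polynomial.C (dilate (ζ ^ i) f)⁻¹ : Polynomial (LaurentSeries K))) q
      have h4 : ∀ F : ℕ → Polynomial (LaurentSeries K),
          ∏ i ∈ Finset.Icc 1 (q : ℕ), F i = ∏ i ∈ Finset.range q, F (i + 1) := by
        intro F
        rw [Finset.range_eq_Ico, Finset.prod_Ico_add' F 0 q 1]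
        rfl
      rw [h4, h4]
      have h5 := Finset.prod_range_succ' (fun i : ℕ =>
        (Polynomial.X - Polynomial.C (dilate (ζ ^ (i + 1)) f)⁻¹ :
          Polynomial (LaurentSeries K))) q
      have h6 := Finset.prod_range_succ (fun i : ℕ =>
        (Polynomial.X - Polynomial.C (dilate (ζ ^ (i + 1)) f)⁻¹ :
          Polynomial (LaurentSeries K))) q
      rw [h6, pow_succ ζ (q : ℕ), hζ.pow_eq_one, one_mul, zero_add, pow_one] at h5
      exact (mul_right_cancel₀ (Polynomial.X_sub_C_ne_zero _) h5).symm
    have hc := congrArg (fun P => (P.coeff b).coeff n) hmap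
    simp only [Polynomial.coeff_map] at hc
    have hc' : ζ ^ n * ((curvePolynomial q ζ f).coeff b).coeff n =
        ((curvePolynomial q ζ f).coeff b).coeff n := hc
    exact (hζ.zpow_eq_one_iff_dvd n).mp ((mul_eq_right₀ hn).mp hc')

/-- The curve germ `C_{f,q} ∈ K[[x,y]]`: the coefficient of `x^a y^b = t^{q a} y^b` is read off
from the product `curvePolynomial`. If `ζ` is a primitive `q`-th root of unity and
`f ≠ 0` has order at most `0`, then nothing is lost, see `curvePolynomial_coeff`. -/
def curveGerm (q : ℕ+) (ζ : K) (f : LaurentSeries K) : MvPowerSeries (Fin 2) K :=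
  fun e => ((curvePolynomial q ζ f).coeff (e 1)).coeff ((q : ℤ) * (e 0 : ℤ))

end Curves

end FormalConnection

end

open scoped TensorProduct

noncomputable section

namespace FormalConnection

/-! ### Series in fractional powers -/

section Series

variable {K : Type*} [Field K]

/-! Write t = x^{1/q} and let σ be the automorphism t ↦ ζt of K((t)), which fixes K((x)). Both sides
of the formula are computed from the pole orders of the differences f - σ^k f.

Irregularity. By independence of characters and a dimension count, End(V) is the direct sum of the
spaces K((t))σ^k. The commutator with ∇ makes the k-th one into E_{f - σ^k f, q} (`connE_hom_iso`).
Any E_{g,q} has irregularity equal to the pole order of g in t, even if g comes from a smaller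
ramification: then E_{g,q} splits into pieces whose pole orders add up to that of g
(`hasIrregularity_connE`). Hence the irregularity of End(V) is the sum of the pole orders of f - σ^k
f. It is independent of the decomposition because a nonzero horizontal map cannot increase the slope
(pole order divided by q), as one sees from the rate at which iterates of ∇ lower orders
(`slope_le_of_horizontal`). An isomorphism has nonzero determinant, so it matches the summands of
two decompositions, counted with dimension, along nonzero components (`HasIrregularity.unique`).

Milnor number. Irreducibility makes f minimally ramified, so f - σ^k f has a genuine pole for 0 < k
< q. With G = 1/f one has G - σ^k G = -(f - σ^k f)/(f · σ^k f), of order 2p minus that pole order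
(`order_sub_rescale_add_poleOrder`). The roots of C are the σ^k G. By Weierstrass division and the
Smith normal form, μ is the x-order of the norm of ∂C/∂x in K[[x]][y]/(∂C/∂y)
(`finrank_intersectionAlgebra`), and by Newton-Puiseux this norm is a product over the branches y =
η(t) of the polar curve ∂C/∂y = 0. On such a branch the chain rule relates C to ∂C/∂x alone, so μ +
(q - 1) is the intersection number of C with its polar curve. Evaluated instead along the roots of
C, this number is the order of the product of the G - σ^k G over 0 < k < q (`order_norm_add`).
Therefore μ + (q - 1) = 2p(q - 1) - Irr(End V). -/

theorem ramHom_ramHom (d r : ℕ+) (a : LaurentSeries K) :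
    ramHom d (ramHom r a) = ramHom (d * r) a := by
  have hd : (d : ℤ) ≠ 0 := by exact_mod_cast d.ne_zero
  have hr : (r : ℤ) ≠ 0 := by exact_mod_cast r.ne_zero
  ext n
  by_cases h : ((d * r : ℕ+) : ℤ) ∣ n
  · obtain ⟨m, rfl⟩ := h
    rw [ramHom_coeff_mul]
    push_cast
    rw [mul_assoc, ramHom_coeff_mul, ramHom_coeff_mul]
  · rw [ramHom_coeff_of_not_dvd _ _ _ h]
    by_cases h' : (d : ℤ) ∣ n
    · obtain ⟨m, rfl⟩ := h'
      rw [ramHom_coeff_mul, ramHom_coeff_of_not_dvd]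
      rintro ⟨k, rfl⟩
      exact h ⟨k, by push_cast; ring⟩
    · exact ramHom_coeff_of_not_dvd _ _ _ h'

theorem ramHom_one (a : LaurentSeries K) : ramHom 1 a = a := by
  ext n
  simpa using ramHom_coeff_mul 1 a n

theorem ramHom_single (q : ℕ+) (n : ℤ) (c : K) :
    ramHom q (HahnSeries.single n c) = HahnSeries.single ((q : ℤ) * n) c := by
  ext m
  by_cases h : (q : ℤ) ∣ m
  · obtain ⟨k, rfl⟩ := h
    rw [ramHom_coeff_mul, HahnSeries.coeff_single, HahnSeries.coeff_single]
    simp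
  · rw [ramHom_coeff_of_not_dvd _ _ _ h, HahnSeries.coeff_single, if_neg]
    rintro rfl
    exact h ⟨n, rfl⟩

theorem ddx_ramHom_mul [CharZero K] (d r : ℕ+) (v : LaurentSeries K) :
    ddx (d * r) (ramHom d v) = ramHom d (ddx r v) := by
  have hd : (d : K) ≠ 0 := by exact_mod_cast d.ne_zero
  have hr : (r : K) ≠ 0 := by exact_mod_cast r.ne_zero
  ext n
  rw [ddx_coeff]
  by_cases hn : (d : ℤ) ∣ n
  · obtain ⟨m, rfl⟩ := hn
    rw [ramHom_coeff_mul, ddx_coeff,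
      show (d : ℤ) * m + ((d * r : ℕ+) : ℤ) = d * (m + r) by push_cast; ring, ramHom_coeff_mul]
    push_cast
    field_simp
  · rw [ramHom_coeff_of_not_dvd _ _ _ hn, ramHom_coeff_of_not_dvd, mul_zero, mul_zero]
    push_cast
    intro h
    exact hn ((Int.dvd_add_left (dvd_mul_right _ _)).mp h)

/-- The monomial x^{j/q} is an eigenvector of x d/dx with eigenvalue j/q. This is the source of the
shifts by (1/q)ℤ when E_{f,q} is split. -/
theorem ddx_single (q : ℕ+) (j : ℤ) :
    ddx q (HahnSeries.single j (1 : K)) =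
      HahnSeries.single (-(q : ℤ)) 1 * HahnSeries.C ((j : K) / q) * HahnSeries.single j 1 := by
  ext n
  rw [ddx_coeff, HahnSeries.C_apply, HahnSeries.single_mul_single, HahnSeries.single_mul_single,
    HahnSeries.coeff_single, HahnSeries.coeff_single]
  by_cases h : n + q = j
  · rw [if_pos h, if_pos (by omega), h]
    ring
  · rw [if_neg h, if_neg (by omega)]
    ring

theorem dilate_coeff (c : K) (f : LaurentSeries K) (n : ℤ) :
    (dilate c f).coeff n = c ^ n * f.coeff n := rfl

theorem ddx_dilate (q : ℕ+) {c : K} (hc : c ^ (q : ℕ) = 1) (v : LaurentSeries K) :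
    ddx q (dilate c v) = dilate c (ddx q v) := by
  have hc0 : c ≠ 0 := by
    rintro rfl
    simp at hc
  ext n
  rw [ddx_coeff, dilate_coeff, dilate_coeff, ddx_coeff, zpow_add₀ hc0,
    show c ^ ((q : ℕ) : ℤ) = 1 by rw [zpow_natCast, hc]]
  ring

theorem dilate_ramHom (q : ℕ+) {c : K} (hc : c ^ (q : ℕ) = 1) (v : LaurentSeries K) :
    dilate c (ramHom q v) = ramHom q v := by
  ext n
  rw [dilate_coeff]
  by_cases h : (q : ℤ) ∣ n
  · obtain ⟨m, rfl⟩ := h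
    rw [zpow_mul, show c ^ ((q : ℕ) : ℤ) = 1 by rw [zpow_natCast, hc], one_zpow, one_mul]
  · rw [ramHom_coeff_of_not_dvd _ _ _ h, mul_zero]

theorem dilate_single (c : K) (n : ℤ) (a : K) :
    dilate c (HahnSeries.single n a) = HahnSeries.single n (c ^ n * a) := by
  ext m
  rw [dilate_coeff, HahnSeries.coeff_single, HahnSeries.coeff_single]
  split_ifs with h
  · rw [h]
  · simp

/-- The series with coefficients `v.coeff (d * m + j)`. -/
def decimate (d : ℕ+) (j : ℤ) (v : LaurentSeries K) : LaurentSeries K :=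
  HahnSeries.ofSuppBddBelow (fun m : ℤ => v.coeff ((d : ℤ) * m + j)) <| by
    refine ⟨-(|v.order| + |j|), fun m hm => ?_⟩
    by_contra hlt
    have hd : (1 : ℤ) ≤ d := by exact_mod_cast d.pos
    have h1 := neg_abs_le v.order
    have h2 := le_abs_self j
    have h3 := abs_nonneg v.order
    have h4 := abs_nonneg j
    have h5 : (d : ℤ) * m ≤ m := by nlinarith
    exact hm (HahnSeries.coeff_eq_zero_of_lt_order (by linarith))

theorem decimate_coeff (d : ℕ+) (j : ℤ) (v : LaurentSeries K) (m : ℤ) :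
    (decimate d j v).coeff m = v.coeff ((d : ℤ) * m + j) := rfl

theorem single_mul_ramHom_coeff (d : ℕ+) (a : LaurentSeries K) (i j : Fin d) (m : ℤ) :
    (HahnSeries.single ((j : ℕ) : ℤ) (1 : K) * ramHom d a).coeff ((d : ℤ) * m + (i : ℕ)) =
      if i = j then a.coeff m else 0 := by
  have := HahnSeries.coeff_single_mul_add (r := (1 : K)) (x := ramHom d a)
    (a := (d : ℤ) * m + (i : ℕ) - (j : ℕ)) (b := ((j : ℕ) : ℤ))
  rw [sub_add_cancel, one_mul] at this
  rw [this]
  split_ifs with h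
  · rw [h, add_sub_cancel_right, ramHom_coeff_mul]
  · rw [ramHom_coeff_of_not_dvd]
    intro hdvd
    rw [add_sub_assoc, Int.dvd_add_right (dvd_mul_right _ _)] at hdvd
    have hi := i.isLt
    have hj := j.isLt
    have := Int.eq_zero_of_abs_lt_dvd hdvd (by rw [abs_lt]; constructor <;> omega)
    exact h (Fin.ext (by omega))

/-- The pole order is bounded by `N` iff there are no exponents below `-N`. -/
theorem poleOrder_le_iff (f : LaurentSeries K) (N : ℕ) :
    poleOrder f ≤ N ↔ ∀ n : ℤ, n < -(N : ℤ) → f.coeff n = 0 := by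
  by_cases hf : f = 0
  · simp [hf, poleOrder]
  · rw [← HahnSeries.le_order_iff_forall hf, poleOrder]
    omega

theorem poleOrder_congr {f g : LaurentSeries K} (h : ∀ n : ℤ, n < 0 → f.coeff n = g.coeff n) :
    poleOrder f = poleOrder g := by
  refine eq_of_forall_ge_iff fun N => ?_
  rw [poleOrder_le_iff, poleOrder_le_iff]
  exact forall₂_congr fun n hn => by rw [h n (by omega)]

theorem coeff_neg_poleOrder_ne_zero {f : LaurentSeries K} (h : 0 < poleOrder f) :
    f.coeff (-(poleOrder f : ℤ)) ≠ 0 := by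
  have hf : f ≠ 0 := by
    rintro rfl
    simp [poleOrder] at h
  have : -(poleOrder f : ℤ) = f.order := by
    unfold poleOrder at h ⊢
    omega
  rw [this]
  simpa using hf

theorem coeff_eq_zero_of_lt_neg_poleOrder {f : LaurentSeries K} {n : ℤ}
    (h : n < -(poleOrder f : ℤ)) : f.coeff n = 0 :=
  (poleOrder_le_iff f _).mp le_rfl n h

theorem poleOrder_ramHom (d : ℕ+) (h : LaurentSeries K) :
    poleOrder (ramHom d h) = d * poleOrder h := by
  have hd : (0 : ℤ) < d := by exact_mod_cast d.pos
  refine eq_of_forall_ge_iff fun N => ?_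
  rw [poleOrder_le_iff]
  constructor
  · intro H
    by_contra! hlt
    have hpos : 0 < poleOrder h := by
      rcases Nat.eq_zero_or_pos (poleOrder h) with h0 | h0
      · simp [h0] at hlt
      · exact h0
    apply coeff_neg_poleOrder_ne_zero hpos
    rw [← ramHom_coeff_mul d]
    apply H
    rw [mul_neg]
    exact neg_lt_neg (by exact_mod_cast hlt)
  · intro H n hn
    by_cases hdvd : (d : ℤ) ∣ n
    · obtain ⟨m, rfl⟩ := hdvd
      rw [ramHom_coeff_mul]
      apply coeff_eq_zero_of_lt_neg_poleOrder
      have H' : (d : ℤ) * poleOrder h ≤ N := by exact_mod_cast H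
      nlinarith
    · exact ramHom_coeff_of_not_dvd _ _ _ hdvd

/-- A linear differential equation of order one with power series coefficient is solvable. -/
theorem exists_derivative_eq_mul [CharZero K] (c : PowerSeries K) :
    ∃ u : PowerSeries K, u ≠ 0 ∧ PowerSeries.derivative K u = c * u := by
  -- The antiderivative of c without constant term, so that exp(w) makes sense and solves the
  -- equation.
  let w : PowerSeries K := PowerSeries.X * PowerSeries.mk fun n => c.coeff n / ((n : K) + 1)
  have hw : PowerSeries.constantCoeff w = 0 := by simp [w]
  have hs : PowerSeries.HasSubst w := PowerSeries.HasSubst.of_constantCoeff_zero' hw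
  have hdw : PowerSeries.derivative K w = c := by
    ext n
    have : ((n : K) + 1) ≠ 0 := by exact_mod_cast n.succ_ne_zero
    rw [PowerSeries.coeff_derivative, PowerSeries.coeff_succ_X_mul, PowerSeries.coeff_mk]
    field_simp
  refine ⟨(PowerSeries.exp K).subst w, ?_, ?_⟩
  · have := (PowerSeries.isUnit_exp K).map (PowerSeries.substAlgHom hs)
    rw [PowerSeries.coe_substAlgHom] at this
    exact this.ne_zero
  · rw [PowerSeries.derivative_subst hs, hdw, mul_comm, PowerSeries.derivative_exp]

theorem derivative_ofPowerSeries (u : PowerSeries K) :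
    LaurentSeries.derivative K (HahnSeries.ofPowerSeries ℤ K u) =
      HahnSeries.ofPowerSeries ℤ K (PowerSeries.derivative K u) := by
  ext n
  rw [derivative_coeff]
  rcases lt_or_ge n 0 with hn | hn
  · rw [PowerSeries.coeff_coe, PowerSeries.coeff_coe, if_pos hn]
    rcases lt_or_ge (n + 1) 0 with hn' | hn'
    · rw [if_pos hn', mul_zero]
    · rw [show n + 1 = 0 by omega]
      simp
  · obtain ⟨k, rfl⟩ := Int.eq_ofNat_of_zero_le hn
    rw [show ((k : ℤ) + 1) = ((k + 1 : ℕ) : ℤ) by push_cast; rfl]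
    rw [HahnSeries.ofPowerSeries_apply_coeff, HahnSeries.ofPowerSeries_apply_coeff,
      PowerSeries.coeff_derivative]
    push_cast
    ring

/-- In the variable t the equation reads du/dt = q (w/t) u, and w/t is a power series because w has
positive order. The solution serves as a gauge transformation removing w. -/
theorem exists_ddx_eq_mul [CharZero K] (q : ℕ+) (w : LaurentSeries K)
    (hw : ∀ n : ℤ, n ≤ 0 → w.coeff n = 0) :
    ∃ u : LaurentSeries K, u ≠ 0 ∧ ddx q u = HahnSeries.single (-(q : ℤ)) 1 * w * u := by
  have hq : (q : K) ≠ 0 := by exact_mod_cast q.ne_zero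
  obtain ⟨u, hu0, hu⟩ := exists_derivative_eq_mul
    (PowerSeries.mk fun n => (q : K) * w.coeff ((n : ℤ) + 1))
  refine ⟨HahnSeries.ofPowerSeries ℤ K u, ?_, ?_⟩
  · rwa [Ne, map_eq_zero_iff _ HahnSeries.ofPowerSeries_injective]
  · rw [ddx_apply, derivative_ofPowerSeries, hu, map_mul, ← mul_assoc]
    congr 1
    have : w = HahnSeries.single (1 : ℤ) ((q : K)⁻¹) * HahnSeries.ofPowerSeries ℤ K
        (PowerSeries.mk fun n => (q : K) * w.coeff ((n : ℤ) + 1)) := by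
      ext n
      have h1 := HahnSeries.coeff_single_mul_add (r := (q : K)⁻¹)
        (x := HahnSeries.ofPowerSeries ℤ K
          (PowerSeries.mk fun n => (q : K) * w.coeff ((n : ℤ) + 1))) (a := n - 1) (b := 1)
      rw [sub_add_cancel] at h1
      rw [h1]
      rcases lt_or_ge (n - 1) 0 with hn | hn
      · rw [PowerSeries.coeff_coe, if_pos hn, hw n (by omega), mul_zero]
      · obtain ⟨k, hk⟩ := Int.eq_ofNat_of_zero_le hn
        rw [hk, HahnSeries.ofPowerSeries_apply_coeff, PowerSeries.coeff_mk,
          show n = (k : ℤ) + 1 by omega]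
        field_simp
    conv_rhs => rw [this]
    rw [← mul_assoc, HahnSeries.single_mul_single, one_mul, neg_add_eq_sub]

end Series

/-! ### Isomorphisms of connections -/

namespace Connection

variable {K : Type*} [Field K]
variable {V W U : Type*} [AddCommGroup V] [Module (LaurentSeries K) V]
  [AddCommGroup W] [Module (LaurentSeries K) W] [AddCommGroup U] [Module (LaurentSeries K) U]
  {D : Connection K V} {D' : Connection K W} {D'' : Connection K U}

theorem Iso.symm (h : D.Iso D') : D'.Iso D := by
  obtain ⟨e, he⟩ := h
  exact ⟨e.symm, fun v => by rw [LinearEquiv.symm_apply_eq, he, LinearEquiv.apply_symm_apply]⟩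

theorem Iso.trans (h : D.Iso D') (h' : D'.Iso D'') : D.Iso D'' := by
  obtain ⟨e, he⟩ := h
  obtain ⟨e', he'⟩ := h'
  exact ⟨e.trans e', fun v => by simp [he, he']⟩

theorem directSum_nabla_apply {r : ℕ} {M : Fin r → Type*} [∀ i, AddCommGroup (M i)]
    [∀ i, Module (LaurentSeries K) (M i)] (D : ∀ i, Connection K (M i)) (v : ∀ i, M i)
    (i : Fin r) : (directSum D).nabla v i = (D i).nabla (v i) := rfl

theorem hom_nabla_apply (D : Connection K V) (D' : Connection K W)
    (φ : V →ₗ[LaurentSeries K] W) (v : V) :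
    (D.hom D').nabla φ v = D'.nabla (φ v) - φ (D.nabla v) := rfl

/-- A direct sum of at least two nonzero connections is reducible. -/
theorem IsIrreducible.eq_one_of_iso_directSum {r : ℕ} {M : Fin r → Type*}
    [∀ i, AddCommGroup (M i)] [∀ i, Module (LaurentSeries K) (M i)] [∀ i, Nontrivial (M i)]
    {E : ∀ i, Connection K (M i)} (hD : D.IsIrreducible) (h : D.Iso (directSum E)) : r = 1 := by
  obtain ⟨e, he⟩ := h
  obtain ⟨hV, hsub⟩ := hD
  have hr : r ≠ 0 := by
    rintro rfl
    obtain ⟨v, hv⟩ := exists_ne (0 : V)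
    exact hv (e.injective (Subsingleton.elim _ _))
  by_contra hr1
  let i₀ : Fin r := ⟨0, by omega⟩
  let i₁ : Fin r := ⟨1, by omega⟩
  have h01 : i₁ ≠ i₀ := by simp [i₀, i₁]
  -- The kernel of the projection to the first summand is stable. It contains the second summand and
  -- misses the first, both nonzero.
  rcases hsub (LinearMap.ker ((LinearMap.proj i₀ : (∀ i, M i) →ₗ[LaurentSeries K] M i₀) ∘ₗ
    e.toLinearMap)) (fun u hu => by
      have hu' : e u i₀ = 0 := hu
      change e (D.nabla u) i₀ = 0
      rw [he, directSum_nabla_apply, hu', map_zero]) with hbot | htop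
  · obtain ⟨m, hm⟩ := exists_ne (0 : M i₁)
    have hmem : e.symm (Pi.single i₁ m) ∈ LinearMap.ker
        ((LinearMap.proj i₀ : (∀ i, M i) →ₗ[LaurentSeries K] M i₀) ∘ₗ e.toLinearMap) := by
      simp [LinearMap.mem_ker, h01.symm]
    rw [hbot, Submodule.mem_bot, LinearEquiv.map_eq_zero_iff, Pi.single_eq_zero_iff] at hmem
    exact hm hmem
  · obtain ⟨m, hm⟩ := exists_ne (0 : M i₀)
    have hmem : e.symm (Pi.single i₀ m) ∈ LinearMap.ker
        ((LinearMap.proj i₀ : (∀ i, M i) →ₗ[LaurentSeries K] M i₀) ∘ₗ e.toLinearMap) := by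
      rw [htop]
      trivial
    simp [LinearMap.mem_ker] at hmem
    exact hm hmem

end Connection

/-! ### The connections E_{f,q}: gauge change, splitting, endomorphisms -/

section ConnE

variable {K : Type*} [Field K]

instance (q : ℕ+) : Nontrivial (Ram K q) := inferInstanceAs (Nontrivial (LaurentSeries K))

theorem connE_nabla_apply [CharZero K] (q : ℕ+) (f : LaurentSeries K) (v : Ram K q) :
    (connE q f).nabla v = toRam q (ddx q ((toRam q).symm v) +
      HahnSeries.single (-(q : ℤ)) (1 : K) * f * (toRam q).symm v) := rfl

/-- `E_{f,q}` depends on `f` only modulo `x^{1/q} K[[x^{1/q}]]`. -/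
theorem connE_iso_of_coeff_eq [CharZero K] (q : ℕ+) {f g : LaurentSeries K}
    (h : ∀ n : ℤ, n ≤ 0 → (f - g).coeff n = 0) : (connE q f).Iso (connE q g) := by
  obtain ⟨u, hu0, hu⟩ := exists_ddx_eq_mul q (f - g) h
  have hu0' : toRam q u ≠ 0 := hu0
  -- If u' = x⁻¹(f - g)u, then multiplication by u is horizontal from E_{f,q} to E_{g,q}.
  refine ⟨LinearEquiv.smulOfNeZero (Ram K q) (Ram K q) (toRam q u) hu0' |>.restrictScalars
    (LaurentSeries K), fun v => ?_⟩
  change toRam q (u * (ddx q ((toRam q).symm v) +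
      HahnSeries.single (-(q : ℤ)) (1 : K) * f * (toRam q).symm v)) =
    toRam q (ddx q (u * (toRam q).symm v) +
      HahnSeries.single (-(q : ℤ)) (1 : K) * g * (u * (toRam q).symm v))
  rw [ddx_mul, hu]
  congr 1
  ring

/-- `K((x^{1/q}))`, `q = d r`, as a direct sum of the `x^{j/q} K((x^{1/r}))`, `0 ≤ j < d`. -/
def ramEquivPi (K : Type*) [Field K] (d r : ℕ+) :
    (Fin d → Ram K r) ≃ₗ[LaurentSeries K] Ram K (d * r) where
  toFun v := toRam (d * r) (∑ j : Fin d, HahnSeries.single ((j : ℕ) : ℤ) (1 : K) *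
    ramHom d ((toRam r).symm (v j)))
  map_add' v w := by
    simp only [Pi.add_apply, map_add, mul_add, Finset.sum_add_distrib]
  map_smul' a v := by
    simp only [Pi.smul_apply, RingHom.id_apply, Ram.smul_eq, RingEquiv.symm_apply_apply, map_mul,
      ramHom_ramHom, Finset.mul_sum]
    congr 1
    exact Finset.sum_congr rfl fun j _ => by ring
  invFun w j := toRam r (decimate d ((j : ℕ) : ℤ) ((toRam (d * r)).symm w))
  left_inv v := by
    funext i
    apply (toRam r).symm.injective
    rw [RingEquiv.symm_apply_apply, RingEquiv.symm_apply_apply]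
    ext m
    rw [decimate_coeff, HahnSeries.coeff_sum]
    simp only [single_mul_ramHom_coeff]
    simp
  right_inv w := by
    apply (toRam (d * r)).symm.injective
    rw [RingEquiv.symm_apply_apply]
    simp only [RingEquiv.symm_apply_apply]
    ext n
    have hd : (0 : ℤ) < d := by exact_mod_cast d.pos
    obtain ⟨k, hk⟩ := Int.eq_ofNat_of_zero_le (Int.emod_nonneg n hd.ne')
    have hkd : k < d := by
      have := Int.emod_lt_of_pos n hd
      omega
    obtain ⟨i, m, hn⟩ : ∃ (i : Fin d) (m : ℤ), n = (d : ℤ) * m + (i : ℕ) := by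
      refine ⟨⟨k, hkd⟩, n / d, ?_⟩
      have := Int.mul_ediv_add_emod n d
      simp only
      omega
    rw [hn, HahnSeries.coeff_sum]
    simp only [single_mul_ramHom_coeff, decimate_coeff]
    simp

theorem ramEquivPi_apply (d r : ℕ+) (v : Fin d → Ram K r) :
    ramEquivPi K d r v = toRam (d * r) (∑ j : Fin d, HahnSeries.single ((j : ℕ) : ℤ) (1 : K) *
      ramHom d ((toRam r).symm (v j))) := rfl

/-- `E_{h,q}` splits if `h` belongs to `K((x^{1/r}))`, `q = d r`. -/
theorem connE_ramHom_iso [CharZero K] (d r : ℕ+) (h : LaurentSeries K) :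
    (connE (d * r) (ramHom d h)).Iso (Connection.directSum fun j : Fin d =>
      connE r (h + HahnSeries.C (((j : ℕ) : K) / ((d * r : ℕ+) : K)))) := by
  apply Connection.Iso.symm
  refine ⟨ramEquivPi K d r, fun v => ?_⟩
  rw [connE_nabla_apply, ramEquivPi_apply, ramEquivPi_apply, RingEquiv.symm_apply_apply,
    map_sum (ddx (d * r)), Finset.mul_sum, ← Finset.sum_add_distrib]
  congr 1
  refine Finset.sum_congr rfl fun j _ => ?_
  rw [Connection.directSum_nabla_apply, connE_nabla_apply, RingEquiv.symm_apply_apply, map_add,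
    map_mul, map_mul, map_add, ramHom_single, ddx_mul, ddx_single, ddx_ramHom_mul,
    HahnSeries.C_apply, ramHom_single, mul_zero]
  simp only [HahnSeries.C_apply]
  push_cast
  rw [mul_neg]
  ring

theorem finrank_ram_one : Module.finrank (LaurentSeries K) (Ram K 1) = 1 := by
  let e : LaurentSeries K ≃ₗ[LaurentSeries K] Ram K 1 :=
    { (toRam (K := K) 1) with
      map_smul' := fun a v => by
        change toRam 1 (a * v) = toRam 1 (ramHom 1 a * v)
        rw [ramHom_one] }
  rw [← e.finrank_eq, Module.finrank_self]

instance : Module.Finite (LaurentSeries K) (Ram K 1) :=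
  Module.finite_of_finrank_pos (by rw [finrank_ram_one]; norm_num)

instance (q : ℕ+) : Module.Finite (LaurentSeries K) (Ram K q) := by
  have := Module.Finite.equiv (ramEquivPi K q 1)
  rwa [mul_one] at this

theorem finrank_ram (q : ℕ+) : Module.finrank (LaurentSeries K) (Ram K q) = q := by
  have := (ramEquivPi K q 1).finrank_eq
  rw [Module.finrank_pi_fintype] at this
  simp only [finrank_ram_one, Finset.sum_const, Finset.card_univ, Fintype.card_fin, smul_eq_mul,
    mul_one] at this
  rw [mul_one] at this
  exact this.symm

/-- `a ↦ a σ`, where `σ` is the automorphism `x^{1/q} ↦ c x^{1/q}`. -/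
def mulDilate (q : ℕ+) (c : K) (hc : c ^ (q : ℕ) = 1) :
    Ram K q →ₗ[LaurentSeries K] Ram K q →ₗ[LaurentSeries K] Ram K q :=
  have hc0 : c ≠ 0 := by
    rintro rfl
    simp at hc
  LinearMap.mk₂ _ (fun a v => a * toRam q (dilateHom c hc0 ((toRam q).symm v)))
    (fun a b v => by rw [add_mul]) (fun s a v => by rw [smul_mul_assoc])
    (fun a v w => by rw [map_add, map_add, map_add, mul_add])
    (fun s a v => by
      rw [Ram.smul_eq, RingEquiv.symm_apply_apply, map_mul, Ram.smul_eq,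
        show dilateHom c hc0 (ramHom q s) = ramHom q s from dilate_ramHom q hc s]
      simp only [map_mul, RingEquiv.apply_symm_apply]
      ring)

theorem mulDilate_apply (q : ℕ+) (c : K) (hc : c ^ (q : ℕ) = 1) (a v : Ram K q) :
    mulDilate q c hc a v = toRam q ((toRam q).symm a * dilate c ((toRam q).symm v)) := rfl

/-- As c^q = 1, the dilation σ by c fixes x and commutes with d/dx. Hence the commutator of ∇ with
aσ is bσ, where b = da/dx + x⁻¹(f - σf)a. -/
theorem hom_nabla_mulDilate [CharZero K] (q : ℕ+) (f : LaurentSeries K) (c : K)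
    (hc : c ^ (q : ℕ) = 1)
    (a : Ram K q) : ((connE q f).hom (connE q f)).nabla (mulDilate q c hc a) =
      mulDilate q c hc ((connE q (f - dilate c f)).nabla a) := by
  have hc0 : c ≠ 0 := by
    rintro rfl
    simp at hc
  ext v
  have hadd : ∀ g h : LaurentSeries K, dilate c (g + h) = dilate c g + dilate c h :=
    map_add (dilateHom c hc0)
  rw [Connection.hom_nabla_apply]
  simp only [mulDilate_apply, connE_nabla_apply, RingEquiv.symm_apply_apply, ← map_sub]
  congr 1
  rw [ddx_mul, hadd, dilate_mul hc0, dilate_mul hc0, ddx_dilate q hc, dilate_single,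
    zpow_neg, zpow_natCast, hc]
  rw [inv_one, one_mul]
  ring

/-- The decomposition of `End(E_{f,q})` along the powers of the automorphism `σ`. -/
theorem connE_hom_iso [CharZero K] (q : ℕ+) {ζ : K} (hζ : IsPrimitiveRoot ζ (q : ℕ))
    (f : LaurentSeries K) :
    ((connE q f).hom (connE q f)).Iso (Connection.directSum fun i : Fin q =>
      connE q (f - dilate (ζ ^ (i : ℕ)) f)) := by
  have hpow : ∀ i : ℕ, (ζ ^ i) ^ (q : ℕ) = 1 := fun i => by
    rw [← pow_mul, mul_comm, pow_mul, hζ.pow_eq_one, one_pow]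
  have hζ0 : ζ ≠ 0 := hζ.ne_zero q.ne_zero
  let Φ : (Fin q → Ram K q) →ₗ[LaurentSeries K] (Ram K q →ₗ[LaurentSeries K] Ram K q) :=
    LinearMap.lsum (LaurentSeries K) (fun _ : Fin q => Ram K q) (LaurentSeries K)
      (fun i => mulDilate q (ζ ^ (i : ℕ)) (hpow i))
  have hΦ : ∀ a, Φ a = ∑ i : Fin q, mulDilate q (ζ ^ (i : ℕ)) (hpow i) (a i) := fun a => by
    simp [Φ, LinearMap.lsum_apply, LinearMap.sum_apply]
  let χ : Fin q → (LaurentSeries K →* LaurentSeries K) := fun i =>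
    (dilateHom (ζ ^ (i : ℕ)) (pow_ne_zero _ hζ0) : LaurentSeries K →* LaurentSeries K)
  -- The powers of σ are told apart by their values on t, so they are distinct characters and hence
  -- linearly independent over K((t)).
  have hχ : Function.Injective χ := by
    intro i j hij
    have h1 := DFunLike.congr_fun hij (HahnSeries.single 1 1)
    change dilate _ _ = dilate _ _ at h1
    rw [dilate_single, dilate_single] at h1
    have h2 := HahnSeries.single_injective _ h1
    simp only [zpow_one, mul_one] at h2
    exact Fin.ext (hζ.pow_inj i.isLt j.isLt h2)
  have hinj : Function.Injective Φ := by
    rw [injective_iff_map_eq_zero]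
    intro a ha
    have hli := (linearIndependent_monoidHom (LaurentSeries K) (LaurentSeries K)).comp χ hχ
    rw [Fintype.linearIndependent_iff] at hli
    funext i
    refine hli (fun i => (toRam q).symm (a i)) ?_ i
    funext v
    have h1 := LinearMap.congr_fun ha (toRam q v)
    rw [hΦ, LinearMap.sum_apply] at h1
    rw [Finset.sum_apply]
    exact h1
  -- Both sides have dimension q² over K((x)), so injectivity is enough.
  have hfin : Module.finrank (LaurentSeries K) (Fin q → Ram K q) =
      Module.finrank (LaurentSeries K) (Ram K q →ₗ[LaurentSeries K] Ram K q) := by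
    rw [Module.finrank_pi_fintype, Module.finrank_linearMap]
    simp [finrank_ram]
  apply Connection.Iso.symm
  refine ⟨LinearEquiv.ofInjectiveOfFinrankEq Φ hinj hfin, fun a => ?_⟩
  have happ : ∀ b, LinearEquiv.ofInjectiveOfFinrankEq Φ hinj hfin b = Φ b := fun _ => rfl
  rw [happ, happ, hΦ, hΦ, map_sum]
  exact Finset.sum_congr rfl fun i _ => (hom_nabla_mulDilate q f _ (hpow i) (a i)).symm

/-- `E_{f,q} ≅ E_{f,q} ⊗ J_1`. -/
theorem connE_iso_tensor [CharZero K] (q : ℕ+) (f : LaurentSeries K) :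
    (connE q f).Iso ((connE q f).tensor (connJ K ((1 : ℕ+) : ℕ))) := by
  let e : Ram K q ≃ₗ[LaurentSeries K]
      Ram K q ⊗[LaurentSeries K] (Fin ((1 : ℕ+) : ℕ) → LaurentSeries K) :=
    (TensorProduct.rid _ _).symm ≪≫ₗ TensorProduct.congr (LinearEquiv.refl _ _)
      (LinearEquiv.funUnique (Fin 1) (LaurentSeries K) (LaurentSeries K)).symm
  have he : ∀ v, e v = v ⊗ₜ fun _ => 1 := fun v => by
    change v ⊗ₜ _ = _
    congr 1
  have hJ : (connJ K ((1 : ℕ+) : ℕ)).nabla (fun _ => 1) = 0 := by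
    have h1 : LaurentSeries.derivative K (1 : LaurentSeries K) = 0 := by
      ext n
      rw [derivative_coeff, HahnSeries.coeff_one]
      split_ifs with h
      · rw [h]
        simp
      · simp
    have h2 : (Matrix.of fun i j : Fin ((1 : ℕ+) : ℕ) =>
        if (i : ℕ) + 1 = j then (1 : LaurentSeries K) else 0) = 0 := by
      ext i j : 2
      have := j.isLt
      simp only [PNat.one_coe] at this
      rw [Matrix.of_apply, Matrix.zero_apply, if_neg (by omega)]
    funext i
    change LaurentSeries.derivative K 1 + (HahnSeries.single (-1 : ℤ) (1 : K) •
      Matrix.toLin' (Matrix.of fun i j : Fin ((1 : ℕ+) : ℕ) =>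
        if (i : ℕ) + 1 = j then (1 : LaurentSeries K) else 0)) (fun _ => 1) i = 0
    rw [h1, h2, map_zero, smul_zero, LinearMap.zero_apply, Pi.zero_apply, add_zero]
  refine ⟨e, fun v => ?_⟩
  rw [he, he]
  change _ = (connE q f).nabla v ⊗ₜ _ + v ⊗ₜ _
  rw [hJ, TensorProduct.tmul_zero, add_zero]

end ConnE

/-! ### Existence of the Hukuhara-Turrittin-Levelt decomposition -/

section Existence

variable {K : Type*} [Field K] [CharZero K]

theorem HasIrregularity.of_iso {V W : Type*} [AddCommGroup V] [Module (LaurentSeries K) V]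
    [AddCommGroup W] [Module (LaurentSeries K) W] {D : Connection K V} {D' : Connection K W}
    {n : ℕ} (h : HasIrregularity D' n) (e : D.Iso D') : HasIrregularity D n := by
  obtain ⟨r, q, m, f, hmin, hiso, hn⟩ := h
  exact ⟨r, q, m, f, hmin, e.trans hiso, hn⟩

theorem HasIrregularity.directSum {r : ℕ} {M : Fin r → Type*} [∀ i, AddCommGroup (M i)]
    [∀ i, Module (LaurentSeries K) (M i)] {E : ∀ i, Connection K (M i)} {n : Fin r → ℕ}
    (h : ∀ i, HasIrregularity (E i) (n i)) :
    HasIrregularity (Connection.directSum E) (∑ i, n i) := by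
  choose R q m f hmin hiso hn using h
  choose e he using hiso
  let s : (Σ i, Fin (R i)) ≃ Fin (∑ i, R i) := finSigmaFinEquiv
  refine ⟨∑ i, R i, fun k => q (s.symm k).1 (s.symm k).2, fun k => m (s.symm k).1 (s.symm k).2,
    fun k => f (s.symm k).1 (s.symm k).2, fun k => hmin _ _, ?_, ?_⟩
  · refine ⟨LinearEquiv.piCongrRight e ≪≫ₗ
      (LinearEquiv.piCurry (LaurentSeries K) (fun i j => Ram K (q i j) ⊗[LaurentSeries K]
        (Fin (m i j : ℕ) → LaurentSeries K))).symm ≪≫ₗ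
      LinearEquiv.piCongrLeft' (LaurentSeries K) (fun x : Σ i, Fin (R i) =>
        Ram K (q x.1 x.2) ⊗[LaurentSeries K] (Fin (m x.1 x.2 : ℕ) → LaurentSeries K)) s,
      fun v => ?_⟩
    funext k
    exact congrFun (he (s.symm k).1 (v (s.symm k).1)) (s.symm k).2
  · rw [Equiv.sum_comp s.symm
      (fun x : Σ i, Fin (R i) => (m x.1 x.2 : ℕ) * poleOrder (f x.1 x.2)), Fintype.sum_sigma]
    exact Finset.sum_congr rfl fun i _ => hn i

theorem hasIrregularity_connE_of_isMinimallyRamified {q : ℕ+} {f : LaurentSeries K}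
    (hf : IsMinimallyRamified q f) : HasIrregularity (connE q f) (poleOrder f) := by
  obtain ⟨e, he⟩ := connE_iso_tensor q f
  refine ⟨1, fun _ => q, fun _ => 1, fun _ => f, fun _ => hf, ?_, by simp⟩
  refine ⟨e ≪≫ₗ (LinearEquiv.funUnique (Fin 1) (LaurentSeries K) _).symm, fun v => ?_⟩
  funext i
  exact he v

theorem coeff_C {K : Type*} [Field K] (c : K) (n : ℤ) :
    (HahnSeries.C c : LaurentSeries K).coeff n = if n = 0 then c else 0 := by
  rw [HahnSeries.C_apply, HahnSeries.coeff_single]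
  congr

/-- A minimal level of ramification, and the splitting of `E_{f,q}` at that level. -/
theorem exists_minimal_level {K : Type*} [Field K] (q : ℕ+) (f : LaurentSeries K) :
    ∃ (d r : ℕ+) (h : LaurentSeries K), q = d * r ∧
      (∀ n : ℤ, n ≤ 0 → (f - ramHom d h).coeff n = 0) ∧
      ∀ r' : ℕ, 0 < r' → r' < r → ¬ ∃ g : LaurentSeries K, LiesIn q r' g ∧ SameClass q f g := by
  classical
  have hex : ∃ r : ℕ, 0 < r ∧ ∃ g : LaurentSeries K, LiesIn q r g ∧ SameClass q f g :=
    ⟨q, q.pos, f, fun n _ => dvd_mul_left _ _, 0, fun n _ => by simp⟩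
  obtain ⟨hr0, g, hg, k, hk⟩ := Nat.find_spec hex
  have hmin : ∀ r' : ℕ, 0 < r' → r' < Nat.find hex →
      ¬ ∃ g : LaurentSeries K, LiesIn q r' g ∧ SameClass q f g :=
    fun r' h0 hlt hc => Nat.find_min hex hlt ⟨h0, hc⟩
  generalize Nat.find hex = r at *
  -- An exponent n with q ∣ nr also satisfies q ∣ nq, hence q ∣ n·gcd(q, r). Minimality of r then
  -- forces r ∣ q.
  have hgcd : LiesIn q (Nat.gcd q r) g := by
    intro n hn
    have h1 := hg n hn
    have h2 : (q : ℤ) ∣ n * q := dvd_mul_left _ _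
    have h3 := Int.dvd_coe_gcd h2 h1
    rw [Int.gcd_mul_left, Nat.cast_mul, Int.natCast_natAbs] at h3
    rw [← dvd_abs, abs_mul, Nat.abs_cast]
    simpa using h3
  have hdvd : r ∣ q := by
    by_contra hnd
    have hlt : Nat.gcd q r < r :=
      lt_of_le_of_ne (Nat.gcd_le_right _ hr0) fun h => hnd (h ▸ Nat.gcd_dvd_left _ _)
    exact hmin _ (Nat.gcd_pos_of_pos_left _ q.pos) hlt ⟨g, hgcd, k, hk⟩
  obtain ⟨d, hd⟩ := hdvd
  have hd0 : 0 < d := Nat.pos_of_ne_zero fun h => q.ne_zero (by rw [hd, h, mul_zero])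
  have hr0' : (r : ℤ) ≠ 0 := by exact_mod_cast hr0.ne'
  lift d to ℕ+ using hd0
  lift r to ℕ+ using hr0
  -- Adding the constant k/q to g turns equality of classes into equality of all coefficients in
  -- degrees ≤ 0; a constant lies in every K((x^{1/r})), so the sum still descends.
  refine ⟨d, r, decimate d 0 (g + HahnSeries.C ((k : K) / q)), ?_, ?_, hmin⟩
  · apply PNat.coe_injective
    rw [hd, PNat.mul_coe, mul_comm]
  · have : ramHom d (decimate d 0 (g + HahnSeries.C ((k : K) / q))) =
        g + HahnSeries.C ((k : K) / q) := by
      ext n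
      by_cases hn : (d : ℤ) ∣ n
      · obtain ⟨m, rfl⟩ := hn
        rw [ramHom_coeff_mul, decimate_coeff, add_zero]
      · rw [ramHom_coeff_of_not_dvd _ _ _ hn, HahnSeries.coeff_add, coeff_C, if_neg, add_zero]
        · by_contra hne
          have h1 := hg n (Ne.symm hne)
          rw [hd, mul_comm n] at h1
          push_cast at h1
          exact hn ((mul_dvd_mul_iff_left hr0').mp h1)
        · rintro rfl
          exact hn (dvd_zero _)
    intro n hn
    rw [this, ← sub_sub]
    exact hk n hn

/-- Descent of minimality to the summands of `E_{f,q}`. -/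
theorem isMinimallyRamified_of_minimal_level {d r : ℕ+} {f h : LaurentSeries K}
    (hfh : ∀ n : ℤ, n ≤ 0 → (f - ramHom d h).coeff n = 0)
    (hmin : ∀ r' : ℕ, 0 < r' → r' < r →
      ¬ ∃ g : LaurentSeries K, LiesIn (d * r) r' g ∧ SameClass (d * r) f g) (j : ℤ) :
    IsMinimallyRamified r (h + HahnSeries.C ((j : K) / ((d * r : ℕ+) : K))) := by
  have hd : (d : ℤ) ≠ 0 := by exact_mod_cast d.ne_zero
  have hd' : (d : K) ≠ 0 := by exact_mod_cast d.ne_zero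
  have hr' : (r : K) ≠ 0 := by exact_mod_cast r.ne_zero
  have hdpos : (0 : ℤ) < d := by exact_mod_cast d.pos
  rintro r' h0 hlt ⟨g, hg, k, hk⟩
  -- The integer comes from k/r - j/(dr) = (dk - j)/(dr).
  refine hmin r' h0 hlt ⟨ramHom d g, ?_, d * k - j, ?_⟩
  · intro n hn
    by_cases hdn : (d : ℤ) ∣ n
    · obtain ⟨m, rfl⟩ := hdn
      rw [ramHom_coeff_mul] at hn
      rw [mul_assoc, PNat.mul_coe, Nat.cast_mul]
      exact mul_dvd_mul_left _ (hg m hn)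
    · exact absurd (ramHom_coeff_of_not_dvd _ _ _ hdn) hn
  · intro n hn
    have h1 := hfh n hn
    have key : f - ramHom d g - HahnSeries.C (((d * k - j : ℤ) : K) / ((d * r : ℕ+) : K)) =
        (f - ramHom d h) + ramHom d (h + HahnSeries.C ((j : K) / ((d * r : ℕ+) : K)) - g -
          HahnSeries.C ((k : K) / r)) := by
      have h2 : ∀ c : K, ramHom d (HahnSeries.C c) = HahnSeries.C c := fun c => by
        rw [HahnSeries.C_apply, ramHom_single, mul_zero]
      rw [map_sub, map_sub, map_add, h2, h2]
      have h3 : (((d * k - j : ℤ) : K) / ((d * r : ℕ+) : K)) =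
          (k : K) / r - (j : K) / ((d * r : ℕ+) : K) := by
        push_cast
        field_simp
      rw [h3, map_sub]
      ring
    rw [key, HahnSeries.coeff_add, h1, zero_add]
    by_cases hdn : (d : ℤ) ∣ n
    · obtain ⟨m, rfl⟩ := hdn
      rw [ramHom_coeff_mul]
      exact hk m (by nlinarith)
    · exact ramHom_coeff_of_not_dvd _ _ _ hdn

theorem poleOrder_add_C {K : Type*} [Field K] (f : LaurentSeries K) (c : K) :
    poleOrder (f + HahnSeries.C c) = poleOrder f :=
  poleOrder_congr fun n hn => by rw [HahnSeries.coeff_add, coeff_C, if_neg hn.ne, add_zero]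

/-- Minimal ramification is not needed: at the minimal level r = q/d there are d summands with the
pole order of h, and passing from h(t) to h(t^d) multiplies the pole order by d. The constants j/q
do not affect poles. -/
theorem hasIrregularity_connE (q : ℕ+) (f : LaurentSeries K) :
    HasIrregularity (connE q f) (poleOrder f) := by
  obtain ⟨d, r, h, rfl, hfh, hmin⟩ := exists_minimal_level q f
  have hiso := (connE_iso_of_coeff_eq (d * r) hfh).trans (connE_ramHom_iso d r h)
  have hsum : poleOrder f = ∑ j : Fin d,
      poleOrder (h + HahnSeries.C (((j : ℕ) : K) / ((d * r : ℕ+) : K))) := by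
    simp only [poleOrder_add_C, Finset.sum_const, Finset.card_univ, Fintype.card_fin, smul_eq_mul]
    rw [← poleOrder_ramHom]
    exact poleOrder_congr fun n hn => sub_eq_zero.mp (hfh n hn.le)
  rw [hsum]
  refine (HasIrregularity.directSum fun j => ?_).of_iso hiso
  apply hasIrregularity_connE_of_isMinimallyRamified
  have hj := isMinimallyRamified_of_minimal_level hfh hmin (j : ℕ)
  rwa [Int.cast_natCast] at hj

/-- The splitting at the minimal level has d = q/r nonzero summands; irreducibility forces d = 1,
that is, r = q. -/
theorem isMinimallyRamified_of_isIrreducible {q : ℕ+} {f : LaurentSeries K}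
    (hf : (connE q f).IsIrreducible) : IsMinimallyRamified q f := by
  obtain ⟨d, r, h, rfl, hfh, hmin⟩ := exists_minimal_level q f
  have hiso := (connE_iso_of_coeff_eq (d * r) hfh).trans (connE_ramHom_iso d r h)
  have hd := hf.eq_one_of_iso_directSum hiso
  rw [PNat.coe_eq_one_iff] at hd
  subst hd
  rw [one_mul] at hmin ⊢
  exact hmin

/-- If f and σ^k f had the same polar part, every exponent n < 0 of f would satisfy ζ^{nk} = 1, so q
∣ nk. Then f would be represented by its terms of degree ≤ 0, which lie in K((x^{1/k})), against
minimality. -/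
theorem exists_coeff_sub_dilate_ne_zero {K : Type*} [Field K] {q : ℕ+} {ζ : K}
    (hζ : IsPrimitiveRoot ζ (q : ℕ)) {f : LaurentSeries K} (hf : IsMinimallyRamified q f)
    {k : ℕ} (hk : 0 < k) (hkq : k < q) :
    ∃ n : ℤ, n < 0 ∧ (f - dilate (ζ ^ k) f).coeff n ≠ 0 := by
  by_contra! H
  refine hf k hk hkq ⟨HahnSeries.truncLT 1 f, fun n hn => ?_, 0, fun n hn => ?_⟩
  · have hn1 : n < 1 := by
      by_contra h1
      exact hn (by rw [HahnSeries.coeff_truncLT, if_neg h1])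
    rw [HahnSeries.coeff_truncLT, if_pos hn1] at hn
    rcases (show n ≤ 0 by omega).lt_or_eq with hneg | rfl
    · have h1 := H n hneg
      rw [HahnSeries.coeff_sub, dilate_coeff, ← one_sub_mul] at h1
      have h2 := (mul_eq_zero.mp h1).resolve_right hn
      rw [sub_eq_zero, ← zpow_natCast, ← zpow_mul, eq_comm, hζ.zpow_eq_one_iff_dvd] at h2
      rwa [mul_comm]
    · simp
  · rw [HahnSeries.coeff_sub, HahnSeries.coeff_sub, HahnSeries.coeff_truncLT,
      if_pos (by omega)]
    simp

theorem hasIrregularity_hom {q : ℕ+} {ζ : K} (hζ : IsPrimitiveRoot ζ (q : ℕ))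
    (f : LaurentSeries K) : HasIrregularity ((connE q f).hom (connE q f))
      (∑ k ∈ Finset.range q, poleOrder (f - dilate (ζ ^ k) f)) := by
  rw [Finset.sum_range]
  exact (HasIrregularity.directSum fun i => hasIrregularity_connE q _).of_iso
    (connE_hom_iso q hζ f)

end Existence

/-! ### Uniqueness of the irregularity -/

section Uniqueness

variable {K : Type*} [Field K]

theorem coeff_mul_eq_zero_of_lt {a b : LaurentSeries K} {α β n : ℤ}
    (ha : ∀ i < α, a.coeff i = 0) (hb : ∀ i < β, b.coeff i = 0) (hn : n < α + β) :
    (a * b).coeff n = 0 := by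
  rw [HahnSeries.coeff_mul]
  refine Finset.sum_eq_zero fun ij hij => ?_
  rw [Finset.mem_antidiagonal] at hij
  rcases lt_or_ge ij.1 α with h | h
  · rw [ha _ h, zero_mul]
  · rw [hb ij.2 (by omega), mul_zero]

theorem coeff_mul_add_of_vanish {a b : LaurentSeries K} {α β : ℤ}
    (ha : ∀ i < α, a.coeff i = 0) (hb : ∀ i < β, b.coeff i = 0) :
    (a * b).coeff (α + β) = a.coeff α * b.coeff β := by
  rw [HahnSeries.coeff_mul]
  refine Finset.sum_eq_single (α, β) (fun ij hij hne => ?_) fun hnot => ?_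
  · rw [Finset.mem_antidiagonal] at hij
    rcases lt_trichotomy ij.1 α with h | h | h
    · rw [ha _ h, zero_mul]
    · exact absurd (Prod.ext h (by omega)) hne
    · rw [hb ij.2 (by omega), mul_zero]
  · by_contra hne
    exact hnot (Finset.mem_antidiagonal.mpr
      ⟨left_ne_zero_of_mul hne, right_ne_zero_of_mul hne, rfl⟩)

theorem coeff_single_mul (a n : ℤ) (c : K) (v : LaurentSeries K) :
    (HahnSeries.single a c * v).coeff n = c * v.coeff (n - a) := by
  have := HahnSeries.coeff_single_mul_add (r := c) (x := v) (a := n - a) (b := a)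
  rwa [sub_add_cancel] at this

theorem sum_single_mul_ramHom_decimate (d : ℕ+) (v : LaurentSeries K) :
    ∑ j : Fin d, HahnSeries.single ((j : ℕ) : ℤ) (1 : K) * ramHom d (decimate d (j : ℕ) v) = v :=
  congrArg (toRam (d * 1)).symm ((ramEquivPi K d 1).right_inv (toRam (d * 1) v))

/-- The series which are the coordinates of an element of `E_{f,q} ⊗ J_m`. -/
def coord {q : ℕ+} {m : ℕ} (u : Ram K q ⊗[LaurentSeries K] (Fin m → LaurentSeries K))
    (k : Fin m) : LaurentSeries K :=
  (toRam q).symm (TensorProduct.piScalarRight (LaurentSeries K) (LaurentSeries K) (Ram K q)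
    (Fin m) u k)

variable {q q' : ℕ+} {m m' : ℕ}

theorem coord_tmul (v : Ram K q) (w : Fin m → LaurentSeries K) (k : Fin m) :
    coord (v ⊗ₜ[LaurentSeries K] w) k = ramHom q (w k) * (toRam q).symm v := rfl

theorem coord_add (u u' : Ram K q ⊗[LaurentSeries K] (Fin m → LaurentSeries K)) (k : Fin m) :
    coord (u + u') k = coord u k + coord u' k := by
  simp [coord]

theorem coord_zero (k : Fin m) :
    coord (0 : Ram K q ⊗[LaurentSeries K] (Fin m → LaurentSeries K)) k = 0 := by
  simp [coord]

theorem coord_sum {ι : Type*} (s : Finset ι)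
    (u : ι → Ram K q ⊗[LaurentSeries K] (Fin m → LaurentSeries K)) (k : Fin m) :
    coord (∑ i ∈ s, u i) k = ∑ i ∈ s, coord (u i) k := by
  simp [coord]

theorem coord_smul (a : LaurentSeries K)
    (u : Ram K q ⊗[LaurentSeries K] (Fin m → LaurentSeries K)) (k : Fin m) :
    coord (a • u) k = ramHom q a * coord u k := by
  simp only [coord, map_smul, Pi.smul_apply]
  rfl

theorem coord_ext {u u' : Ram K q ⊗[LaurentSeries K] (Fin m → LaurentSeries K)}
    (h : ∀ k, coord u k = coord u' k) : u = u' := by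
  apply (TensorProduct.piScalarRight (LaurentSeries K) (LaurentSeries K) (Ram K q)
    (Fin m)).injective
  funext k
  exact (toRam q).symm.injective (h k)

/-- The element `x^{j/q}` in position `k`. -/
def monomialVec (q : ℕ+) (m : ℕ) (k : Fin m) (j : Fin q) :
    Ram K q ⊗[LaurentSeries K] (Fin m → LaurentSeries K) :=
  toRam q (HahnSeries.single ((j : ℕ) : ℤ) (1 : K)) ⊗ₜ Pi.single k 1

theorem eq_sum_decimate_smul (u : Ram K q ⊗[LaurentSeries K] (Fin m → LaurentSeries K)) :
    u = ∑ k : Fin m, ∑ j : Fin q, decimate q (j : ℕ) (coord u k) • monomialVec q m k j := by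
  refine coord_ext fun l => ?_
  simp only [coord_sum, coord_smul, monomialVec, coord_tmul, RingEquiv.symm_apply_apply]
  rw [Finset.sum_eq_single l]
  · simp only [Pi.single_eq_same, map_one, one_mul]
    conv_lhs => rw [← sum_single_mul_ramHom_decimate q (coord u l)]
    exact Finset.sum_congr rfl fun j _ => mul_comm _ _
  · intro k _ hk
    simp [Pi.single_eq_of_ne hk.symm]
  · simp

theorem coord_nabla [CharZero K] (f : LaurentSeries K)
    (u : Ram K q ⊗[LaurentSeries K] (Fin m → LaurentSeries K)) (k : Fin m) :
    coord (((connE q f).tensor (connJ K m)).nabla u) k =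
      ddx q (coord u k) + HahnSeries.single (-(q : ℤ)) 1 * f * coord u k +
      HahnSeries.single (-(q : ℤ)) 1 *
        ∑ j : Fin m, if (k : ℕ) + 1 = j then coord u j else 0 := by
  induction u using TensorProduct.induction_on with
  | zero => simp [coord_zero]
  | add u u' hu hu' =>
    have : ∀ j : Fin m, (if (k : ℕ) + 1 = j then coord u j + coord u' j else 0) =
        (if (k : ℕ) + 1 = j then coord u j else 0) +
          (if (k : ℕ) + 1 = j then coord u' j else 0) := fun j => by split_ifs <;> simp
    rw [map_add, coord_add, hu, hu']
    simp only [coord_add, map_add, this, Finset.sum_add_distrib]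
    ring
  | tmul v w =>
    change coord ((connE q f).nabla v ⊗ₜ w + v ⊗ₜ (connJ K m).nabla w) k = _
    have hJ : (connJ K m).nabla w k = LaurentSeries.derivative K (w k) +
        HahnSeries.single (-1 : ℤ) (1 : K) * ∑ j : Fin m, if (k : ℕ) + 1 = j then w j else 0 := by
      change _ + (HahnSeries.single (-1 : ℤ) (1 : K) •
        Matrix.toLin' (Matrix.of fun i j : Fin m =>
          if (i : ℕ) + 1 = j then (1 : LaurentSeries K) else 0)) w k = _
      rw [LinearMap.smul_apply, Pi.smul_apply, Matrix.toLin'_apply, smul_eq_mul]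
      congr 2
      simp [Matrix.mulVec, dotProduct]
    have hsum : ramHom q (∑ j : Fin m, if (k : ℕ) + 1 = j then w j else 0) * (toRam q).symm v =
        ∑ j : Fin m, if (k : ℕ) + 1 = j then ramHom q (w j) * (toRam q).symm v else 0 := by
      rw [map_sum, Finset.sum_mul]
      refine Finset.sum_congr rfl fun j _ => ?_
      split_ifs <;> simp
    simp only [coord_add, coord_tmul, hJ, connE_nabla_apply, RingEquiv.symm_apply_apply, map_add,
      map_mul, ramHom_single, ← hsum, ddx_mul, ddx_ramHom]
    rw [mul_neg_one]
    ring

/-- All coordinates have order at least `M`. -/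
def VanishBelow (u : Ram K q ⊗[LaurentSeries K] (Fin m → LaurentSeries K)) (M : ℤ) : Prop :=
  ∀ (k : Fin m) (n : ℤ), n < M → (coord u k).coeff n = 0

theorem VanishBelow.mono {u : Ram K q ⊗[LaurentSeries K] (Fin m → LaurentSeries K)} {M M' : ℤ}
    (h : VanishBelow u M) (hM : M' ≤ M) : VanishBelow u M' :=
  fun k n hn => h k n (by omega)

theorem exists_vanishBelow (u : Ram K q ⊗[LaurentSeries K] (Fin m → LaurentSeries K)) :
    ∃ M, VanishBelow u M := by
  obtain ⟨M, hM⟩ := Finite.exists_ge fun k => (coord u k).order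
  exact ⟨M, fun k n hn => HahnSeries.coeff_eq_zero_of_lt_order (hn.trans_le (hM k))⟩

theorem exists_vanishBelow_coeff_ne_zero
    {u : Ram K q ⊗[LaurentSeries K] (Fin m → LaurentSeries K)} (hu : u ≠ 0) :
    ∃ M, VanishBelow u M ∧ ∃ k, (coord u k).coeff M ≠ 0 := by
  classical
  obtain ⟨k₁, hk₁⟩ : ∃ k, coord u k ≠ 0 := by
    by_contra! h
    exact hu (coord_ext fun k => by rw [h, coord_zero])
  obtain ⟨k, hk, hmin⟩ := Finset.exists_min_image (Finset.univ.filter fun k => coord u k ≠ 0)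
    (fun k => (coord u k).order) ⟨k₁, by simpa using hk₁⟩
  refine ⟨(coord u k).order, fun l n hn => ?_, k, ?_⟩
  · by_cases hl : coord u l = 0
    · simp [hl]
    · exact HahnSeries.coeff_eq_zero_of_lt_order (hn.trans_le (hmin l (by simpa using hl)))
  · simpa using hk

section

variable [CharZero K] {f : LaurentSeries K}
  {u : Ram K q ⊗[LaurentSeries K] (Fin m → LaurentSeries K)} {M : ℤ}

/-- Both d/dx and the nilpotent term lower the order in t by at most q, so in degrees below M - q
only multiplication by x⁻¹f is visible. -/
theorem coord_nabla_coeff (h : VanishBelow u M) (k : Fin m) {n : ℤ}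
    (hn : n < M - q) : (coord (((connE q f).tensor (connJ K m)).nabla u) k).coeff n =
      (f * coord u k).coeff (n + q) := by
  have h1 : ∀ j, (coord u j).coeff (n + q) = 0 := fun j => h j _ (by omega)
  rw [coord_nabla, HahnSeries.coeff_add, HahnSeries.coeff_add, ddx_coeff, h1, mul_assoc,
    coeff_single_mul, coeff_single_mul, sub_neg_eq_add, HahnSeries.coeff_sum,
    Finset.sum_eq_zero (s := Finset.univ)]
  · simp
  · intro j _
    split_ifs
    · exact h1 j
    · simp

theorem VanishBelow.nabla (h : VanishBelow u M) :
    VanishBelow (((connE q f).tensor (connJ K m)).nabla u) (M - q - poleOrder f) := by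
  intro k n hn
  rw [coord_nabla_coeff h k (by omega)]
  exact coeff_mul_eq_zero_of_lt (fun i hi => coeff_eq_zero_of_lt_neg_poleOrder hi) (h k)
    (by omega)

theorem VanishBelow.coeff_nabla (h : VanishBelow u M) (hf : 0 < poleOrder f) (k : Fin m) :
    (coord (((connE q f).tensor (connJ K m)).nabla u) k).coeff (M - q - poleOrder f) =
      f.coeff (-(poleOrder f : ℤ)) * (coord u k).coeff M := by
  rw [coord_nabla_coeff h k (by omega), ← coeff_mul_add_of_vanish
    (fun i hi => coeff_eq_zero_of_lt_neg_poleOrder hi) (h k)]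
  congr 1
  ring

theorem VanishBelow.nabla_iterate (h : VanishBelow u M) (N : ℕ) :
    VanishBelow (((connE q f).tensor (connJ K m)).nabla^[N] u)
      (M - N * ((q : ℤ) + poleOrder f)) := by
  induction N with
  | zero => simpa using h
  | succ N ih =>
    rw [Function.iterate_succ_apply']
    refine ih.nabla.mono (le_of_eq ?_)
    push_cast
    ring

/-- If f has a pole, each application of ∇ multiplies the lowest coefficient by the leading
coefficient of f. The order therefore drops by exactly q plus the pole order every time, without
cancellation. -/
theorem VanishBelow.coeff_nabla_iterate_ne_zero (h : VanishBelow u M) (hf : 0 < poleOrder f)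
    {k : Fin m} (hk : (coord u k).coeff M ≠ 0) (N : ℕ) :
    (coord (((connE q f).tensor (connJ K m)).nabla^[N] u) k).coeff
      (M - N * ((q : ℤ) + poleOrder f)) ≠ 0 := by
  induction N with
  | zero => simpa using hk
  | succ N ih =>
    rw [Function.iterate_succ_apply']
    have := (h.nabla_iterate (f := f) N).coeff_nabla hf k
    rw [show M - ((N + 1 : ℕ) : ℤ) * ((q : ℤ) + poleOrder f) =
      M - N * ((q : ℤ) + poleOrder f) - q - poleOrder f by push_cast; ring, this]
    exact mul_ne_zero (coeff_neg_poleOrder_ne_zero hf) ih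

end

/-- Linear maps are bounded. -/
theorem exists_vanishBelow_map
    (φ : Ram K q ⊗[LaurentSeries K] (Fin m → LaurentSeries K) →ₗ[LaurentSeries K]
      Ram K q' ⊗[LaurentSeries K] (Fin m' → LaurentSeries K)) :
    ∃ B : ℤ, ∀ u (α : ℤ), VanishBelow u (q * α) → VanishBelow (φ u) (q' * α + B) := by
  have hq : (0 : ℤ) < q := by exact_mod_cast q.pos
  have hq' : (0 : ℤ) < q' := by exact_mod_cast q'.pos
  choose B hB using fun kj : Fin m × Fin q => exists_vanishBelow (φ (monomialVec q m kj.1 kj.2))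
  -- A common lower bound for the orders of the images of the finitely many vectors x^{j/q}, 0 ≤ j <
  -- q, which span over K((x)).
  obtain ⟨B₀, hB₀⟩ := Finite.exists_ge B
  refine ⟨B₀, fun u α hu l n hn => ?_⟩
  rw [eq_sum_decimate_smul u]
  simp only [map_sum, map_smul, coord_sum, coord_smul, HahnSeries.coeff_sum]
  refine Finset.sum_eq_zero fun k _ => Finset.sum_eq_zero fun j _ => ?_
  refine coeff_mul_eq_zero_of_lt (α := q' * α) (β := B₀) (fun i hi => ?_)
    ((hB (k, j)).mono (hB₀ (k, j)) l) hn
  by_cases hd : (q' : ℤ) ∣ i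
  · obtain ⟨a, rfl⟩ := hd
    rw [ramHom_coeff_mul, decimate_coeff]
    apply hu
    have ha : a + 1 ≤ α := lt_of_mul_lt_mul_left hi hq'.le
    have hj : ((j : ℕ) : ℤ) < q := by exact_mod_cast j.isLt
    nlinarith
  · exact ramHom_coeff_of_not_dvd _ _ _ hd

/-- Nonzero horizontal maps cannot increase the slope. -/
theorem slope_le_of_horizontal [CharZero K] {f f' : LaurentSeries K}
    (φ : Ram K q ⊗[LaurentSeries K] (Fin m → LaurentSeries K) →ₗ[LaurentSeries K]
      Ram K q' ⊗[LaurentSeries K] (Fin m' → LaurentSeries K))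
    (hφ : ∀ u, φ (((connE q f).tensor (connJ K m)).nabla u) =
      ((connE q' f').tensor (connJ K m')).nabla (φ u)) (hne : φ ≠ 0) :
    q * poleOrder f' ≤ q' * poleOrder f := by
  have hq : (1 : ℤ) ≤ q := by exact_mod_cast q.pos
  rcases Nat.eq_zero_or_pos (poleOrder f') with h0 | hpos
  · simp [h0]
  obtain ⟨u, hu⟩ : ∃ u, φ u ≠ 0 := by
    by_contra! h
    exact hne (LinearMap.ext h)
  obtain ⟨M, hM⟩ := exists_vanishBelow u
  obtain ⟨M', hM', k, hk⟩ := exists_vanishBelow_coeff_ne_zero hu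
  obtain ⟨B, hB⟩ := exists_vanishBelow_map φ
  have hiter : ∀ N : ℕ, φ (((connE q f).tensor (connJ K m)).nabla^[N] u) =
      ((connE q' f').tensor (connJ K m')).nabla^[N] (φ u) := by
    intro N
    induction N with
    | zero => rfl
    | succ N ih => rw [Function.iterate_succ_apply', Function.iterate_succ_apply', hφ, ih]
  have hM0 : VanishBelow u (q * (-|M|)) := hM.mono (by
    have := neg_abs_le M
    have := abs_nonneg M
    nlinarith)
  by_contra! hlt
  have hlt' : (q' : ℤ) * poleOrder f + 1 ≤ q * poleOrder f' := by exact_mod_cast hlt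
  -- Apply ∇ exactly ql times; the factor q makes the order bound on the source a multiple of q, as
  -- the bound on φ requires. With P, P' the pole orders of f, f', the image has a nonzero
  -- coefficient in degree M' - ql(q' + P') but must vanish below q'(-|M| - l(q + P)) + B. Since qP'
  -- - q'P ≥ 1, this choice of l makes the two incompatible.
  let l : ℕ := (M' + q' * |M| - B + 1).toNat
  have hl : M' + q' * |M| - B + 1 ≤ (l : ℤ) := Int.self_le_toNat _
  have h1 := hB _ (-|M| - l * ((q : ℤ) + poleOrder f))
    ((hM0.nabla_iterate (f := f) (q * l)).mono (le_of_eq (by push_cast; ring)))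
  rw [hiter] at h1
  refine hM'.coeff_nabla_iterate_ne_zero hpos hk (q * l) (h1 k _ ?_)
  push_cast
  have hl0 : (0 : ℤ) ≤ l := by positivity
  nlinarith

/-- Two bases can be matched along nonzero coordinates. -/
theorem exists_equiv_repr_ne_zero {F V ι ι' : Type*} [Field F] [AddCommGroup V] [Module F V]
    [Fintype ι] (b : Module.Basis ι F V) (b' : Module.Basis ι' F V) :
    ∃ σ : ι ≃ ι', ∀ x, b'.repr (b x) (σ x) ≠ 0 := by
  classical
  let ε := b.indexEquiv b'
  have hdet := ((b'.reindex ε.symm).isUnit_det b).ne_zero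
  rw [Module.Basis.det_apply, Matrix.det_apply] at hdet
  -- The transition matrix has nonzero determinant, so some term of its Leibniz expansion is
  -- nonzero; its permutation is the matching.
  obtain ⟨τ, -, hτ⟩ := Finset.exists_ne_zero_of_sum_ne_zero hdet
  refine ⟨τ.trans ε, fun x hx => hτ ?_⟩
  rw [Finset.prod_eq_zero (Finset.mem_univ x), smul_zero]
  rw [Module.Basis.toMatrix_apply, Module.Basis.repr_reindex_apply]
  exact hx

/-- An isomorphism of direct sums has enough nonzero components. -/
theorem exists_equiv_component_ne_zero {F : Type*} [Field F] {ι ι' : Type*} [Fintype ι]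
    [Fintype ι'] [DecidableEq ι] {M : ι → Type*} {M' : ι' → Type*} [∀ i, AddCommGroup (M i)]
    [∀ i, Module F (M i)] [∀ i, Module.Finite F (M i)] [∀ i, AddCommGroup (M' i)]
    [∀ i, Module F (M' i)] [∀ i, Module.Finite F (M' i)] (e : (∀ i, M i) ≃ₗ[F] (∀ i, M' i)) :
    ∃ σ : (Σ i, Fin (Module.finrank F (M i))) ≃ (Σ i, Fin (Module.finrank F (M' i))),
      ∀ x, ∃ u, e (Pi.single x.1 u) (σ x).1 ≠ 0 := by
  obtain ⟨σ, hσ⟩ := exists_equiv_repr_ne_zero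
    ((Pi.basis fun i => Module.finBasis F (M i)).map e)
    (Pi.basis fun i => Module.finBasis F (M' i))
  refine ⟨σ, fun x => ⟨Module.finBasis F (M x.1) x.2, fun hz => hσ x ?_⟩⟩
  rw [Module.Basis.map_apply, Pi.basis_repr, Pi.basis_apply, hz, map_zero, Finsupp.zero_apply]

theorem finrank_tensor (q : ℕ+) (m : ℕ) : Module.finrank (LaurentSeries K)
    (Ram K q ⊗[LaurentSeries K] (Fin m → LaurentSeries K)) = q * m := by
  rw [Module.finrank_tensorProduct, finrank_ram, Module.finrank_fin_fun]

theorem slope_le_of_component_ne_zero [CharZero K] {r r' : ℕ} {q m : Fin r → ℕ+}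
    {q' m' : Fin r' → ℕ+} {f : Fin r → LaurentSeries K} {f' : Fin r' → LaurentSeries K}
    (e : (∀ i, Ram K (q i) ⊗[LaurentSeries K] (Fin (m i : ℕ) → LaurentSeries K))
      ≃ₗ[LaurentSeries K]
      (∀ i, Ram K (q' i) ⊗[LaurentSeries K] (Fin (m' i : ℕ) → LaurentSeries K)))
    (he : ∀ v, e ((Connection.directSum fun i =>
        (connE (q i) (f i)).tensor (connJ K (m i))).nabla v) =
      (Connection.directSum fun i => (connE (q' i) (f' i)).tensor (connJ K (m' i))).nabla (e v))
    (i : Fin r) (j : Fin r')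
    (u : Ram K (q i) ⊗[LaurentSeries K] (Fin (m i : ℕ) → LaurentSeries K))
    (hu : e (Pi.single i u) j ≠ 0) :
    q i * poleOrder (f' j) ≤ q' j * poleOrder (f i) := by
  refine slope_le_of_horizontal (f := f i) (f' := f' j)
    ((LinearMap.proj j : (∀ i, Ram K (q' i) ⊗[LaurentSeries K]
      (Fin (m' i : ℕ) → LaurentSeries K)) →ₗ[LaurentSeries K] _) ∘ₗ e.toLinearMap ∘ₗ
      LinearMap.single (LaurentSeries K) (fun i => Ram K (q i) ⊗[LaurentSeries K]
        (Fin (m i : ℕ) → LaurentSeries K)) i) (fun u => ?_)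
    (fun h0 => hu (LinearMap.congr_fun h0 u))
  change e (Pi.single i (((connE (q i) (f i)).tensor (connJ K (m i))).nabla u)) j =
    ((connE (q' j) (f' j)).tensor (connJ K (m' j))).nabla (e (Pi.single i u) j)
  have h1 := congrFun (he (Pi.single i u)) j
  rw [Connection.directSum_nabla_apply] at h1
  rw [← h1]
  refine congrFun (congrArg e (funext fun l => ?_)) _
  rw [Connection.directSum_nabla_apply]
  rcases eq_or_ne l i with rfl | hne
  · simp
  · simp [Pi.single_eq_of_ne hne]

/-- The i-th summand has dimension q_i m_i, so counting its slope once per dimension gives m_i times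
the pole order. -/
theorem sum_poleOrder_div {r : ℕ} (q m : Fin r → ℕ+) (f : Fin r → LaurentSeries K) :
    ∑ x : (Σ i, Fin (Module.finrank (LaurentSeries K)
      (Ram K (q i) ⊗[LaurentSeries K] (Fin (m i : ℕ) → LaurentSeries K)))),
      (poleOrder (f x.1) : ℚ) / q x.1 = ((∑ i, (m i : ℕ) * poleOrder (f i) : ℕ) : ℚ) := by
  rw [Fintype.sum_sigma]
  push_cast
  refine Finset.sum_congr rfl fun i _ => ?_
  have hq : (q i : ℚ) ≠ 0 := by exact_mod_cast (q i).ne_zero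
  simp only [Finset.sum_const, Finset.card_univ, Fintype.card_fin, finrank_tensor]
  rw [nsmul_eq_mul]
  push_cast
  field_simp

/-- Sum the slope inequality over a matching of the summands, repeated according to dimension. The
opposite inequality comes from the inverse isomorphism. -/
theorem sum_mul_poleOrder_le_of_iso [CharZero K] {r r' : ℕ} {q m : Fin r → ℕ+}
    {q' m' : Fin r' → ℕ+} {f : Fin r → LaurentSeries K} {f' : Fin r' → LaurentSeries K}
    (h : (Connection.directSum fun i => (connE (q i) (f i)).tensor (connJ K (m i))).Iso
      (Connection.directSum fun i => (connE (q' i) (f' i)).tensor (connJ K (m' i)))) :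
    ∑ i, (m' i : ℕ) * poleOrder (f' i) ≤ ∑ i, (m i : ℕ) * poleOrder (f i) := by
  obtain ⟨e, he⟩ := h
  obtain ⟨σ, hσ⟩ := exists_equiv_component_ne_zero e
  have hslope : ∀ x, (poleOrder (f' (σ x).1) : ℚ) / q' (σ x).1 ≤ poleOrder (f x.1) / q x.1 := by
    intro x
    have hq : (0 : ℚ) < q x.1 := by exact_mod_cast (q x.1).pos
    have hq' : (0 : ℚ) < q' (σ x).1 := by exact_mod_cast (q' (σ x).1).pos
    rw [div_le_div_iff₀ hq' hq]
    obtain ⟨u, hu⟩ := hσ x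
    have h1 := slope_le_of_component_ne_zero e he x.1 (σ x).1 u hu
    have h2 : (q x.1 : ℚ) * poleOrder (f' (σ x).1) ≤ q' (σ x).1 * poleOrder (f x.1) := by
      exact_mod_cast h1
    linarith
  have := Finset.sum_le_sum fun x (_ : x ∈ Finset.univ) => hslope x
  rw [σ.sum_comp (fun y => (poleOrder (f' y.1) : ℚ) / q' y.1), sum_poleOrder_div,
    sum_poleOrder_div] at this
  exact_mod_cast this

/-- The irregularity does not depend on the decomposition. -/
theorem HasIrregularity.unique [CharZero K] {V : Type*} [AddCommGroup V]
    [Module (LaurentSeries K) V] {D : Connection K V} {n n' : ℕ} (h : HasIrregularity D n)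
    (h' : HasIrregularity D n') : n = n' := by
  obtain ⟨r, q, m, f, -, hiso, rfl⟩ := h
  obtain ⟨r', q', m', f', -, hiso', rfl⟩ := h'
  exact le_antisymm (sum_mul_poleOrder_le_of_iso (hiso'.symm.trans hiso))
    (sum_mul_poleOrder_le_of_iso (hiso.symm.trans hiso'))

end Uniqueness

/-! ### Puiseux series -/

section Puiseux

open Polynomial

theorem splits_scaleRoots {R : Type*} [CommRing R] [IsDomain R] {P : R[X]} (hP : P.Splits)
    (r : R) : (P.scaleRoots r).Splits := by
  induction hP using Submonoid.closure_induction with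
  | mem x hx =>
    rcases hx with ⟨a, rfl⟩ | ⟨a, rfl⟩
    · rw [scaleRoots_C]
      exact Splits.C a
    · have : (X + C a : R[X]).scaleRoots r = X + C (a * r) := by
        ext n
        rw [coeff_scaleRoots, natDegree_X_add_C]
        rcases n with _ | _ | n
        · simp
        · simp
        · simp [coeff_X]
      rw [this]
      exact Splits.X_add_C _
  | one => simp
  | mul x y _ _ hx hy =>
    rw [mul_scaleRoots_of_noZeroDivisors]
    exact hx.mul hy

variable {K : Type*} [Field K]

instance : IsAdicComplete (IsLocalRing.maximalIdeal (PowerSeries K)) (PowerSeries K) := by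
  rw [PowerSeries.maximalIdeal_eq_span_X]
  infer_instance

theorem mem_maximalIdeal_iff (a : PowerSeries K) :
    a ∈ IsLocalRing.maximalIdeal (PowerSeries K) ↔ PowerSeries.constantCoeff a = 0 := by
  rw [PowerSeries.maximalIdeal_eq_span_X, Ideal.mem_span_singleton, PowerSeries.X_dvd_iff]

/-- A monic polynomial over `K[[t]]` which modulo `t` vanishes at the origin, but is not a power
of the variable, is reducible. -/
theorem exists_factorization_of_constantCoeff {P : (PowerSeries K)[X]} (hP : P.Monic)
    (h0 : PowerSeries.constantCoeff (P.coeff 0) = 0)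
    (hne : ∃ i < P.natDegree, PowerSeries.constantCoeff (P.coeff i) ≠ 0) :
    ∃ g h : (PowerSeries K)[X], P = g * h ∧ g.Monic ∧ h.Monic ∧ g.natDegree < P.natDegree ∧
      h.natDegree < P.natDegree := by
  have hmap : (P : PowerSeries (PowerSeries K)).map (IsLocalRing.residue (PowerSeries K)) ≠ 0 := by
    intro h
    have h1 := congrArg (PowerSeries.coeff P.natDegree) h
    rw [PowerSeries.coeff_map, coeff_coe, hP.coeff_natDegree, map_one] at h1
    exact one_ne_zero h1
  obtain ⟨g, u, hg, hu, hgu⟩ := PowerSeries.exists_isWeierstrassFactorization hmap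
  -- Weierstrass preparation gives P = g·u only among power series in the variable. Division by the
  -- distinguished g identifies the polynomial and the power series quotients, so g divides P
  -- already among polynomials.
  have hdvd : g ∣ P := by
    have h1 : hg.algEquivQuotient (Ideal.Quotient.mk _ P) = 0 := by
      rw [Polynomial.IsDistinguishedAt.algEquivQuotient_apply]
      change Ideal.Quotient.mk _ (P : PowerSeries (PowerSeries K)) = 0
      rw [Ideal.Quotient.eq_zero_iff_mem, hgu, Ideal.mem_span_singleton]
      exact dvd_mul_right _ _
    rw [EmbeddingLike.map_eq_zero_iff, Ideal.Quotient.eq_zero_iff_mem,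
      Ideal.mem_span_singleton] at h1
    exact h1
  obtain ⟨h, rfl⟩ := hdvd
  have hh : h.Monic := hg.monic.of_mul_monic_left hP
  have hdeg := hg.monic.natDegree_mul hh
  refine ⟨g, h, rfl, hg.monic, hh, ?_, ?_⟩
  -- If h = 1, then P is distinguished, so its lower coefficients vanish modulo t, against `hne`. If
  -- g = 1, then P is a unit as a power series, against `h0`.
  · by_contra hlt
    have hh0 : h = 1 := hh.natDegree_eq_zero.mp (by omega)
    obtain ⟨i, hi, hine⟩ := hne
    rw [hh0, mul_one] at hi hine
    exact hine ((mem_maximalIdeal_iff _).mp (hg.mem hi))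
  · by_contra hlt
    have hg0 : g = 1 := hg.monic.natDegree_eq_zero.mp (by omega)
    rw [hg0, coe_one, one_mul, one_mul] at hgu
    rw [← hgu] at hu
    have h1 := PowerSeries.isUnit_constantCoeff _ hu
    rw [← PowerSeries.coeff_zero_eq_constantCoeff_apply, coeff_coe] at h1
    have h2 := PowerSeries.isUnit_constantCoeff _ h1
    rw [hg0, one_mul] at h0
    rw [h0] at h2
    exact not_isUnit_zero h2

/-- `P` becomes a product of linear factors after adjoining a root of the variable. -/
def SplitsAfterExpand (P : (PowerSeries K)[X]) : Prop :=
  ∃ (m : ℕ) (hm : m ≠ 0),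
    (P.map (PowerSeries.expand m hm : PowerSeries K →ₐ[K] PowerSeries K).toRingHom).Splits

theorem SplitsAfterExpand.of_map_expand {P : (PowerSeries K)[X]} {m : ℕ} (hm : m ≠ 0)
    (h : SplitsAfterExpand
      (P.map (PowerSeries.expand m hm : PowerSeries K →ₐ[K] PowerSeries K).toRingHom)) :
    SplitsAfterExpand P := by
  obtain ⟨n, hn, h⟩ := h
  refine ⟨n * m, mul_ne_zero hn hm, ?_⟩
  rw [Polynomial.map_map] at h
  rwa [PowerSeries.expand_mul_eq_comp n hn m hm]

theorem SplitsAfterExpand.mul {P Q : (PowerSeries K)[X]} (hP : SplitsAfterExpand P)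
    (hQ : SplitsAfterExpand Q) : SplitsAfterExpand (P * Q) := by
  obtain ⟨m, hm, hP⟩ := hP
  obtain ⟨n, hn, hQ⟩ := hQ
  refine ⟨n * m, mul_ne_zero hn hm, ?_⟩
  rw [Polynomial.map_mul]
  refine Splits.mul ?_ ?_
  · rw [PowerSeries.expand_mul_eq_comp n hn m hm]
    have := hP.map (PowerSeries.expand n hn : PowerSeries K →ₐ[K] PowerSeries K).toRingHom
    rwa [Polynomial.map_map] at this
  · have h1 : (PowerSeries.expand (n * m) (mul_ne_zero hn hm) :
        PowerSeries K →ₐ[K] PowerSeries K) =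
        (PowerSeries.expand m hm).comp (PowerSeries.expand n hn) := by
      rw [← PowerSeries.expand_mul_eq_comp m hm n hn]
      congr 1
      exact mul_comm n m
    rw [h1]
    have := hQ.map (PowerSeries.expand m hm : PowerSeries K →ₐ[K] PowerSeries K).toRingHom
    rwa [Polynomial.map_map] at this

theorem SplitsAfterExpand.of_taylor {P : (PowerSeries K)[X]} (a : PowerSeries K)
    (h : SplitsAfterExpand (P.taylor a)) : SplitsAfterExpand P := by
  obtain ⟨m, hm, h⟩ := h
  refine ⟨m, hm, ?_⟩
  have h1 := h.taylor (-(PowerSeries.expand m hm a))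
  rwa [map_taylor, taylor_taylor, show -(PowerSeries.expand m hm a) +
    (PowerSeries.expand m hm : PowerSeries K →ₐ[K] PowerSeries K).toRingHom a = 0 from
      neg_add_cancel _, taylor_zero] at h1

theorem SplitsAfterExpand.scaleRoots {P : (PowerSeries K)[X]} (hP : P.Monic) (a : PowerSeries K)
    (h : SplitsAfterExpand P) : SplitsAfterExpand (P.scaleRoots a) := by
  obtain ⟨m, hm, h⟩ := h
  refine ⟨m, hm, ?_⟩
  rw [map_scaleRoots _ _ _ (by rw [hP.leadingCoeff, map_one]; exact one_ne_zero)]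
  exact splits_scaleRoots h _

/-- A reduction of Newton's algorithm: a monic polynomial of degree `d` without term in degree
`d - 1`, not a power of the variable modulo `t`, factors up to a translation. -/
theorem exists_factorization_taylor [IsAlgClosed K] [CharZero K] {Q : (PowerSeries K)[X]}
    (hQ : Q.Monic) {d : ℕ} (hd : Q.natDegree = d + 1) (hnext : Q.coeff d = 0)
    (hne : ∃ i ≤ d, PowerSeries.constantCoeff (Q.coeff i) ≠ 0) :
    ∃ (a : PowerSeries K) (g h : (PowerSeries K)[X]), Q.taylor a = g * h ∧ g.Monic ∧ h.Monic ∧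
      g.natDegree < d + 1 ∧ h.natDegree < d + 1 := by
  let Q₀ : K[X] := Q.map PowerSeries.constantCoeff
  have hQ₀ : Q₀.Monic := hQ.map _
  have hdeg₀ : Q₀.natDegree = d + 1 := by rw [hQ.natDegree_map, hd]
  obtain ⟨c, hc⟩ := IsAlgClosed.exists_root Q₀ (by
    rw [degree_eq_natDegree hQ₀.ne_zero, hdeg₀]
    exact_mod_cast d.succ_ne_zero)
  have hmap : (Q.taylor (PowerSeries.C c)).map PowerSeries.constantCoeff = Q₀.taylor c := by
    rw [map_taylor]
    simp [Q₀]
  have hmonic : (Q.taylor (PowerSeries.C c)).Monic := by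
    rw [Monic, leadingCoeff_taylor, hQ.leadingCoeff]
  obtain ⟨g, h, hgh, hg, hh, hgd, hhd⟩ := exists_factorization_of_constantCoeff hmonic (by
      rw [← coeff_map, hmap, taylor_coeff_zero]
      exact hc) (by
    -- Otherwise Q modulo t equals (X - c)^{d+1}. Its coefficient -(d+1)c in degree d vanishes, so c
    -- = 0 in characteristic zero and Q is a power of the variable modulo t, against `hne`.
    by_contra! H
    rw [natDegree_taylor, hd] at H
    have h1 : Q₀.taylor c = X ^ (d + 1) := by
      ext i
      rw [coeff_X_pow]
      rcases lt_trichotomy i (d + 1) with hi | hi | hi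
      · rw [if_neg hi.ne, ← hmap, coeff_map, H i hi]
      · rw [if_pos hi, hi, ← hdeg₀, ← natDegree_taylor Q₀ c]
        change (Q₀.taylor c).leadingCoeff = 1
        rw [leadingCoeff_taylor, hQ₀.leadingCoeff]
      · rw [if_neg hi.ne', coeff_eq_zero_of_natDegree_lt (by rwa [natDegree_taylor, hdeg₀])]
    have h2 : Q₀ = (X - C c) ^ (d + 1) := by
      apply taylor_injective c
      rw [h1, taylor_pow]
      simp
    have h3 : Q₀.coeff d = 0 := by rw [coeff_map, hnext, map_zero]
    have hc0 : c = 0 := by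
      rw [h2, sub_eq_add_neg, ← C_neg, coeff_X_add_C_pow] at h3
      simp at h3
      rcases h3 with h3 | h3
      · exact h3
      · exact absurd h3 (by exact_mod_cast d.succ_ne_zero)
    obtain ⟨i, hi, hine⟩ := hne
    apply hine
    rw [← coeff_map]
    change Q₀.coeff i = 0
    rw [h2, hc0, C_0, sub_zero, coeff_X_pow, if_neg (by omega)])
  rw [natDegree_taylor, hd] at hgd hhd
  exact ⟨_, g, h, hgh, hg, hh, hgd, hhd⟩

/-- **Newton-Puiseux theorem**: monic polynomials over `K[[t]]` split over some `K[[t^{1/m}]]`. -/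
theorem splitsAfterExpand [IsAlgClosed K] [CharZero K] (P : (PowerSeries K)[X]) (hP : P.Monic) :
    SplitsAfterExpand P := by
  classical
  induction hn : P.natDegree using Nat.strong_induction_on generalizing P with
  | _ n ih =>
    obtain _ | d := n
    · rw [hP.natDegree_eq_zero.mp hn]
      exact ⟨1, one_ne_zero, by simp⟩
    have hd0 : ((d : K) + 1) ≠ 0 := by exact_mod_cast d.succ_ne_zero
    have hlead : P.coeff (d + 1) = 1 := hn ▸ hP.coeff_natDegree
    wlog hnext : P.coeff d = 0 generalizing P
    -- Tschirnhaus translation: in characteristic zero the coefficient of degree d can be shifted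
    -- away.
    · let a : PowerSeries K := -(PowerSeries.C ((d : K) + 1)⁻¹ * P.coeff d)
      apply SplitsAfterExpand.of_taylor a
      refine this _ (by rw [Monic, leadingCoeff_taylor, hP.leadingCoeff])
        (by rw [natDegree_taylor, hn]) ?_ ?_
      · have h1 : (P.taylor a).natDegree = d + 1 := by rw [natDegree_taylor, hn]
        rw [← h1]
        change (P.taylor a).leadingCoeff = 1
        rw [leadingCoeff_taylor, hP.leadingCoeff]
      rw [taylor_coeff]
      have h1 : (hasseDeriv d P).natDegree ≤ 1 := by
        refine (natDegree_hasseDeriv_le _ _).trans ?_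
        omega
      rw [eval_eq_sum_range' (Nat.lt_succ_of_le h1), Finset.sum_range_succ, Finset.sum_range_one,
        hasseDeriv_coeff, hasseDeriv_coeff, zero_add, add_comm 1 d, hlead]
      have h2 : ((d + 1 : ℕ) : PowerSeries K) = PowerSeries.C ((d : K) + 1) := by
        rw [← Nat.cast_succ, map_natCast]
      rw [Nat.choose_self, Nat.choose_succ_self_right, h2]
      simp only [a, Nat.cast_one, one_mul, pow_zero, mul_one, pow_one, mul_neg]
      rw [← mul_assoc, ← map_mul, mul_inv_cancel₀ hd0, map_one, one_mul, add_neg_cancel]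
    by_cases hX : ∀ i < d + 1, P.coeff i = 0
    · have : P = X ^ (d + 1) := by
        ext1 i
        rw [coeff_X_pow]
        rcases lt_trichotomy i (d + 1) with hi | hi | hi
        · rw [if_neg hi.ne, hX i hi]
        · rw [if_pos hi, hi, ← hn, hP.coeff_natDegree]
        · rw [if_neg hi.ne', coeff_eq_zero_of_natDegree_lt (by omega)]
      exact ⟨1, one_ne_zero, by simp [this]⟩
    -- The minimal quotient ord(P_i)/(d + 1 - i) = v/e is a slope of the Newton polygon. After t ↦
    -- t^e the roots can be divided by t^v, and minimality is exactly what keeps the rescaled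
    -- coefficients integral.
    obtain ⟨i₀, hi₀, hmin⟩ := Finset.exists_min_image
      ((Finset.range (d + 1)).filter fun i => P.coeff i ≠ 0)
      (fun i => ((P.coeff i).order.toNat : ℚ) / ((d + 1 - i : ℕ) : ℚ)) (by
        push Not at hX
        obtain ⟨i, hi, hne⟩ := hX
        exact ⟨i, by simp [hi, hne]⟩)
    rw [Finset.mem_filter, Finset.mem_range] at hi₀
    obtain ⟨hi₀d, hi₀⟩ := hi₀
    have he : d + 1 - i₀ ≠ 0 := by omega
    set v := (P.coeff i₀).order.toNat with hv
    set e := d + 1 - i₀ with he_def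
    have hdvd : ∀ i, PowerSeries.X ^ (v * (d + 1 - i)) ∣ PowerSeries.expand e he (P.coeff i) := by
      intro i
      by_cases h0 : P.coeff i = 0
      · rw [h0, map_zero]
        exact dvd_zero _
      rcases lt_or_ge i (d + 1) with hi | hi
      · have h1 := hmin i (by simp [hi, h0])
        have hpos : (0 : ℚ) < (d + 1 - i : ℕ) := by exact_mod_cast Nat.sub_pos_of_lt hi
        have hpos' : (0 : ℚ) < (e : ℚ) := by exact_mod_cast Nat.pos_of_ne_zero he
        rw [div_le_div_iff₀ hpos' hpos] at h1
        have h2 : v * (d + 1 - i) ≤ e * (P.coeff i).order.toNat := by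
          rw [mul_comm e]
          exact_mod_cast h1
        refine (pow_dvd_pow _ h2).trans ?_
        have h3 := map_dvd (PowerSeries.expand e he : PowerSeries K →ₐ[K] PowerSeries K)
          (PowerSeries.X_pow_order_dvd (φ := P.coeff i))
        rwa [map_pow, PowerSeries.expand_X, ← pow_mul] at h3
      · rw [Nat.sub_eq_zero_of_le hi, mul_zero, pow_zero]
        exact one_dvd _
    choose b hb using hdvd
    let Q : (PowerSeries K)[X] := ∑ i ∈ Finset.range (d + 2), monomial i (b i)
    have hQc : ∀ i, Q.coeff i = if i < d + 2 then b i else 0 := by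
      intro i
      simp only [Q, finsetSum_coeff, coeff_monomial, Finset.sum_ite_eq', Finset.mem_range]
    have hblead : b (d + 1) = 1 := by
      have := hb (d + 1)
      rw [hlead, map_one, Nat.sub_self, mul_zero, pow_zero, one_mul] at this
      exact this.symm
    have hQd : Q.natDegree = d + 1 := by
      refine natDegree_eq_of_le_of_coeff_ne_zero ?_ ?_
      · rw [natDegree_le_iff_coeff_eq_zero]
        intro i hi
        rw [hQc, if_neg (by omega)]
      · rw [hQc, if_pos (by omega), hblead]
        exact one_ne_zero
    have hQ : Q.Monic := by
      rw [Monic, leadingCoeff, hQd, hQc, if_pos (by omega), hblead]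
    have hPQ : P.map (PowerSeries.expand e he : PowerSeries K →ₐ[K] PowerSeries K).toRingHom =
        Q.scaleRoots (PowerSeries.X ^ v) := by
      ext1 i
      rw [coeff_map, coeff_scaleRoots, hQd, hQc]
      change PowerSeries.expand e he (P.coeff i) = _
      split_ifs with hi
      · rw [hb, mul_comm, pow_mul]
      · rw [coeff_eq_zero_of_natDegree_lt (by omega), map_zero, zero_mul]
    -- The minimum is attained at i₀, so the rescaled coefficient there has nonzero constant term;
    -- the coefficient of degree d is still zero.
    obtain ⟨a, g, h, hgh, hg, hh, hgd, hhd⟩ := exists_factorization_taylor hQ hQd (by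
        rw [hQc, if_pos (by omega)]
        have h1 := hb d
        rw [hnext, map_zero] at h1
        exact (mul_eq_zero.mp h1.symm).resolve_left (pow_ne_zero _ PowerSeries.X_ne_zero))
      ⟨i₀, by omega, by
        rw [hQc, if_pos (by omega)]
        have h1 := congrArg (PowerSeries.coeff (e * v)) (hb i₀)
        rw [PowerSeries.coeff_expand_mul, mul_comm e v, ← he_def, PowerSeries.coeff_X_pow_mul',
          if_pos le_rfl, Nat.sub_self] at h1
        rw [← PowerSeries.coeff_zero_eq_constantCoeff_apply, ← h1]
        exact PowerSeries.coeff_order hi₀⟩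
    apply SplitsAfterExpand.of_map_expand he
    rw [hPQ]
    apply SplitsAfterExpand.scaleRoots hQ
    apply SplitsAfterExpand.of_taylor a
    rw [hgh]
    exact (ih _ hgd g hg rfl).mul (ih _ hhd h hh rfl)

end Puiseux

/-! ### Intersection numbers and norms -/

section Intersection

open Polynomial

variable {K : Type*} [Field K]

theorem finrank_quotient_span_powerSeries {a : PowerSeries K} (ha : a ≠ 0) :
    Module.Finite K (PowerSeries K ⧸ Ideal.span {a}) ∧
      Module.finrank K (PowerSeries K ⧸ Ideal.span {a}) = a.order.toNat := by
  set n := a.order.toNat with hn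
  let φ : PowerSeries K →ₗ[K] (Fin n → K) := LinearMap.pi fun i => PowerSeries.coeff (i : ℕ)
  have hφ : Function.Surjective φ := by
    intro v
    refine ⟨PowerSeries.mk fun i => if h : i < n then v ⟨i, h⟩ else 0, ?_⟩
    funext i
    simp [φ]
  have hker : LinearMap.ker φ = (Ideal.span {a}).restrictScalars K := by
    ext b
    rw [LinearMap.mem_ker, Submodule.restrictScalars_mem, Ideal.mem_span_singleton]
    have h1 : a ∣ b ↔ PowerSeries.X ^ n ∣ b := by
      have hassoc : Associated (PowerSeries.X ^ n) a :=
        ⟨(PowerSeries.isUnit_divided_by_X_pow_order ha).unit,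
          PowerSeries.X_pow_order_mul_divXPowOrder⟩
      exact hassoc.symm.dvd_iff_dvd_left
    rw [h1, PowerSeries.X_pow_dvd_iff]
    constructor
    · intro h i hi
      exact congrFun h ⟨i, hi⟩
    · intro h
      funext i
      exact h i i.isLt
  let e : (PowerSeries K ⧸ Ideal.span {a}) ≃ₗ[K] (Fin n → K) :=
    (Submodule.quotEquivOfEq _ _ hker.symm : (PowerSeries K ⧸
      (Ideal.span {a}).restrictScalars K) ≃ₗ[K] _) ≪≫ₗ
      φ.quotKerEquivOfSurjective hφ
  exact ⟨Module.Finite.equiv e.symm, by rw [e.finrank_eq, Module.finrank_fin_fun]⟩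

theorem order_eq_of_associated {a b : PowerSeries K} (h : Associated a b) : a.order = b.order := by
  obtain ⟨u, rfl⟩ := h
  rw [PowerSeries.order_mul, PowerSeries.order_zero_of_unit u.isUnit, add_zero]

/-- The colength of a principal ideal in a finite free algebra over `K[[x]]`. -/
theorem finrank_quotient_span_singleton {S ι : Type*} [CommRing S] [Algebra (PowerSeries K) S]
    [Algebra K S] [IsScalarTower K (PowerSeries K) S] [Fintype ι]
    (b : Module.Basis ι (PowerSeries K) S) {h : S} (hh : Algebra.norm (PowerSeries K) h ≠ 0) :
    Module.Finite K (S ⧸ Ideal.span {h}) ∧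
      Module.finrank K (S ⧸ Ideal.span {h}) = (Algebra.norm (PowerSeries K) h).order.toNat := by
  classical
  have : Module.Finite (PowerSeries K) S := Module.Finite.of_basis b
  have : Module.Free (PowerSeries K) S := Module.Free.of_basis b
  let φ : S →ₗ[PowerSeries K] S := Algebra.lmul (PowerSeries K) S h
  have hdet : LinearMap.det φ ≠ 0 := hh
  have hinj : Function.Injective φ := by
    rw [← LinearMap.ker_eq_bot]
    by_contra hk
    exact hdet (LinearMap.det_eq_zero_iff_ker_ne_bot.mpr hk)
  let N : Submodule (PowerSeries K) S := (Ideal.span {h}).restrictScalars (PowerSeries K)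
  have hN : LinearMap.range φ = N := by
    ext x
    rw [LinearMap.mem_range, Submodule.restrictScalars_mem, Ideal.mem_span_singleton']
    exact ⟨fun ⟨y, hy⟩ => ⟨y, by rw [mul_comm]; exact hy⟩,
      fun ⟨y, hy⟩ => ⟨y, by rw [mul_comm] at hy; exact hy⟩⟩
  have hrank : Module.finrank (PowerSeries K) N = Module.finrank (PowerSeries K) S := by
    rw [← hN, LinearMap.finrank_range_of_inj hinj]
  let e₀ : S ≃ₗ[PowerSeries K] N :=
    (LinearEquiv.ofInjective φ hinj) ≪≫ₗ LinearEquiv.ofEq _ _ hN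
  have he₀ : ∀ x, (e₀ x : S) = φ x := fun _ => rfl
  let b' := Submodule.smithNormalFormTopBasis b hrank
  let a := Submodule.smithNormalFormCoeffs b hrank
  let ab := Submodule.smithNormalFormBotBasis b hrank
  have hab : ∀ i, (ab i : S) = a i • b' i := Submodule.smithNormalFormBotBasis_def b hrank
  -- In the adapted bases the diagonal map of invariant factors has the same image as multiplication
  -- by h. The two differ by an automorphism of S, hence their determinants by a unit.
  have hassoc : Associated (∏ i, a i) (Algebra.norm (PowerSeries K) h) := by
    rw [← Matrix.det_diagonal, ← LinearMap.det_toLin b']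
    let e : S ≃ₗ[PowerSeries K] S := (b'.equiv ab (Equiv.refl _)) ≪≫ₗ e₀.symm
    refine LinearMap.associated_det_of_eq_comp e _ φ fun x => ?_
    have : Matrix.toLin b' b' (Matrix.diagonal a) = φ ∘ₗ e.toLinearMap := by
      refine b'.ext fun i => ?_
      rw [Matrix.toLin_self, LinearMap.comp_apply, ← he₀]
      simp only [e, LinearEquiv.coe_coe, LinearEquiv.trans_apply, LinearEquiv.apply_symm_apply,
        Module.Basis.equiv_apply, Equiv.refl_apply, hab]
      simp [Matrix.diagonal_apply]
    rw [this]
    rfl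
  have ha : ∀ i, a i ≠ 0 := Submodule.smithNormalFormCoeffs_ne_zero b hrank
  let E : (S ⧸ Ideal.span {h}) ≃ₗ[K] (∀ i, PowerSeries K ⧸ Ideal.span {a i}) :=
    (Submodule.quotientEquivPiSpan N b hrank).restrictScalars K
  have := fun i => (finrank_quotient_span_powerSeries (ha i)).1
  refine ⟨Module.Finite.equiv E.symm, ?_⟩
  rw [E.finrank_eq, Module.finrank_pi_fintype, ← order_eq_of_associated hassoc,
    PowerSeries.order_prod]
  rw [ENat.toNat_sum]
  · exact Finset.sum_congr rfl fun i _ => (finrank_quotient_span_powerSeries (ha i)).2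
  · intro i _
    rw [Ne, PowerSeries.order_eq_top]
    exact ha i

/-- The determinant of a polynomial in a matrix, in terms of the eigenvalues. -/
theorem det_aeval_eq_prod_roots {R n : Type*} [CommRing R] [IsDomain R] [Fintype n]
    [DecidableEq n] (M : Matrix n n R) (hM : M.charpoly.Splits) (H : R[X]) :
    (aeval M H).det = (M.charpoly.roots.map fun η => H.eval η).prod := by
  -- Over an algebraic closure H is a product of constants and linear factors. Both sides are
  -- multiplicative in H, and the linear case is the value of the characteristic polynomial at -a.
  wlog hH : H.Splits generalizing R
  · let Ω := AlgebraicClosure (FractionRing R)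
    let ψ : R →+* Ω := (algebraMap (FractionRing R) Ω).comp (algebraMap R (FractionRing R))
    have hψ : Function.Injective ψ := (algebraMap (FractionRing R) Ω).injective.comp
      (IsFractionRing.injective R (FractionRing R))
    apply hψ
    have h1 := this (M.map ψ) (by rw [Matrix.charpoly_map]; exact hM.map ψ) (H.map ψ)
      (IsAlgClosed.splits _)
    have h2 : (aeval M H).map ψ = aeval (M.map ψ) (H.map ψ) := by
      refine map_aeval_eq_aeval_map (φ := ψ) (ψ := ψ.mapMatrix) ?_ H M
      ext r i j
      simp [Matrix.algebraMap_matrix_apply]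
      split_ifs <;> simp
    rw [← h2, Matrix.charpoly_map, hM.roots_map_of_injective hψ] at h1
    rw [RingHom.map_det, map_multiset_prod, Multiset.map_map]
    rw [Multiset.map_map] at h1
    refine h1.trans ?_
    congr 1
    refine Multiset.map_congr rfl fun η _ => ?_
    simp [eval_map, eval₂_at_apply]
  have hcard : M.charpoly.roots.card = Fintype.card n := by
    rw [← hM.natDegree_eq_card_roots, Matrix.charpoly_natDegree_eq_dim]
  induction hH using Submonoid.closure_induction with
  | mem x hx =>
    rcases hx with ⟨a, rfl⟩ | ⟨a, rfl⟩
    · simp [hcard, Matrix.algebraMap_eq_diagonal, Matrix.det_diagonal]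
    · have h1 := Matrix.eval_charpoly M (-a)
      rw [hM.eval_eq_prod_roots_of_monic (Matrix.charpoly_monic M)] at h1
      have h2 : Matrix.scalar n (-a) - M = -(aeval M (X + C a)) := by
        rw [map_add, aeval_X, aeval_C]
        simp [Matrix.algebraMap_eq_diagonal, sub_eq_add_neg, add_comm]
      have h3 : M.charpoly.roots.map (fun η => -a - η) =
          (M.charpoly.roots.map fun η => eval η (X + C a)).map Neg.neg := by
        rw [Multiset.map_map]
        refine Multiset.map_congr rfl fun η _ => ?_
        simp only [Function.comp_apply, eval_add, eval_X, eval_C]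
        ring
      rw [h2, Matrix.det_neg, h3, Multiset.prod_map_neg, Multiset.card_map, hcard] at h1
      exact (mul_left_cancel₀ (pow_ne_zero _ (neg_ne_zero.mpr one_ne_zero)) h1).symm
  | one => simp
  | mul x y _ _ hx hy => simp [hx, hy, Matrix.det_mul, Multiset.prod_map_mul]

/-- The norm on `A[Y]/(P)` in terms of the roots of `P`. -/
theorem map_norm_adjoinRoot_mk {A R : Type*} [CommRing A] [IsDomain A] [CommRing R] [IsDomain R]
    (ψ : A →+* R) {P : A[X]} (hP : P.Monic) (hs : (P.map ψ).Splits) (H : A[X]) :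
    ψ (Algebra.norm A (AdjoinRoot.mk P H)) =
      ((P.map ψ).roots.map fun η => (H.map ψ).eval η).prod := by
  classical
  let pb := AdjoinRoot.powerBasis' hP
  let M := Algebra.leftMulMatrix pb.basis (AdjoinRoot.root P)
  have hM : M.charpoly = P := by
    -- Cayley-Hamilton: the characteristic polynomial kills the class of the variable, so P divides
    -- it; both are monic of the same degree.
    have h1 : P ∣ M.charpoly := by
      rw [← AdjoinRoot.mk_eq_zero, ← AdjoinRoot.aeval_eq]
      apply Algebra.leftMulMatrix_injective pb.basis
      rw [map_zero, ← Polynomial.aeval_algHom_apply]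
      exact Matrix.aeval_self_charpoly M
    refine eq_of_monic_of_dvd_of_natDegree_le hP (Matrix.charpoly_monic M) h1 ?_
    rw [Matrix.charpoly_natDegree_eq_dim, Fintype.card_fin]
    exact le_of_eq (AdjoinRoot.powerBasis'_dim hP)
  have h2 : (aeval M H).map ψ = aeval (M.map ψ) (H.map ψ) := by
    refine map_aeval_eq_aeval_map (φ := ψ) (ψ := ψ.mapMatrix) ?_ H M
    ext r i j
    simp [Matrix.algebraMap_matrix_apply]
    split_ifs <;> simp
  rw [Algebra.norm_eq_matrix_det pb.basis, ← AdjoinRoot.aeval_eq, ← Polynomial.aeval_algHom_apply,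
    RingHom.map_det]
  change ((aeval M H).map ψ).det = _
  have h3 : (M.map ψ).charpoly = P.map ψ := by rw [Matrix.charpoly_map, hM]
  rw [h2, det_aeval_eq_prod_roots _ (by rw [h3]; exact hs), h3]

/-- `K[[x, y]]` as the ring of power series in `y` over `K[[x]]`. -/
def iteratedEquiv (K : Type*) [Field K] :
    MvPowerSeries (Fin 2) K ≃ₐ[K] PowerSeries (PowerSeries K) :=
  (MvPowerSeries.renameEquiv K (finSuccEquivLast (n := 1) |>.trans
    (Equiv.optionCongr (Equiv.ofUnique (Fin 1) Unit)))).trans (MvPowerSeries.optionEquivLeft Unit K)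

theorem coeff_iteratedEquiv (g : MvPowerSeries (Fin 2) K) (a b : ℕ) :
    PowerSeries.coeff a (PowerSeries.coeff b (iteratedEquiv K g)) =
      MvPowerSeries.coeff (Finsupp.single 0 a + Finsupp.single 1 b) g := by
  let σ : Fin 2 ≃ Option Unit := (finSuccEquivLast (n := 1)).trans
    (Equiv.optionCongr (Equiv.ofUnique (Fin 1) Unit))
  have h0 : σ 0 = some () := rfl
  have h1 : σ 1 = none := rfl
  have h2 : (Finsupp.single () a).optionElim b =
      Finsupp.embDomain σ.toEmbedding (Finsupp.single 0 a + Finsupp.single 1 b) := by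
    ext x
    obtain ⟨i, rfl⟩ := σ.surjective x
    rw [show σ i = σ.toEmbedding i from rfl, Finsupp.embDomain_apply_self]
    change (Finsupp.single () a).optionElim b (σ i) = _
    fin_cases i
    · simp [h0]
    · simp [h1]
  have h3 := MvPowerSeries.coeff_embDomain_rename (R := K) σ.toEmbedding g
    (Finsupp.single 0 a + Finsupp.single 1 b)
  rw [← h2] at h3
  exact (MvPowerSeries.coeff_coeff_optionEquivLeft _ _ _).trans h3

/-- Weierstrass division identifies the quotients of the polynomial and the power series rings. -/
theorem exists_ringEquiv_quotient_coe {A : Type*} [CommRing A] {I : Ideal A} [IsAdicComplete I A]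
    {P : A[X]} (hP : P.IsDistinguishedAt I) :
    ∃ e : AdjoinRoot P ≃+* PowerSeries A ⧸ Ideal.span {(P : PowerSeries A)},
      ∀ Q : A[X], e (AdjoinRoot.mk P Q) = Ideal.Quotient.mk _ (Q : PowerSeries A) :=
  ⟨hP.algEquivQuotient.toRingEquiv, fun Q => by
    change hP.algEquivQuotient (Ideal.Quotient.mk _ Q) = _
    rw [Polynomial.IsDistinguishedAt.algEquivQuotient_apply]
    rfl⟩

/-- Intersection numbers with a Weierstrass polynomial. -/
theorem finrank_intersectionAlgebra {g h : MvPowerSeries (Fin 2) K} {P H : (PowerSeries K)[X]}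
    (hP : P.IsDistinguishedAt (IsLocalRing.maximalIdeal (PowerSeries K)))
    {c : K} (hc : c ≠ 0) (hg : iteratedEquiv K g = (H : PowerSeries (PowerSeries K)))
    (hh : iteratedEquiv K h = ((C (PowerSeries.C c) * P : (PowerSeries K)[X]) :
      PowerSeries (PowerSeries K)))
    (hnorm : Algebra.norm (PowerSeries K) (AdjoinRoot.mk P H) ≠ 0) :
    Module.Finite K (IntersectionAlgebra g h) ∧ intersectionNumber g h =
      (Algebra.norm (PowerSeries K) (AdjoinRoot.mk P H)).order.toNat := by
  let A := PowerSeries K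
  let I : Ideal (PowerSeries A) := Ideal.span {(P : PowerSeries A)}
  let J : Ideal (PowerSeries A) := Ideal.span {(H : PowerSeries A)}
  have hunit : IsUnit ((C (PowerSeries.C c) : A[X]) : PowerSeries A) := by
    rw [coe_C]
    exact ((IsUnit.mk0 c hc).map PowerSeries.C).map PowerSeries.C
  have hIJ : I ⊔ J = (Ideal.span {g, h}).map (iteratedEquiv K) := by
    rw [Ideal.map_span, Set.image_pair, hg, hh, Ideal.span_insert, sup_comm, coe_mul]
    congr 1
    exact (Ideal.span_singleton_mul_left_unit hunit _).symm
  -- Dividing by the distinguished P first leaves K[[x]][y]/(P), finite and free over K[[x]], where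
  -- the colength of H is the order of its norm.
  obtain ⟨ε, hε⟩ := exists_ringEquiv_quotient_coe hP
  let e₀ : AdjoinRoot P ≃ₐ[K] PowerSeries A ⧸ I := AlgEquiv.ofRingEquiv (f := ε) fun r => by
    have h1 : algebraMap K (AdjoinRoot P) r = AdjoinRoot.mk P (C (PowerSeries.C r)) := rfl
    have h2 : algebraMap K (PowerSeries A) r = PowerSeries.C (PowerSeries.C r) := by
      rw [PowerSeries.algebraMap_apply, PowerSeries.algebraMap_apply]
      rfl
    rw [h1, hε, coe_C]
    exact congrArg (Ideal.Quotient.mk I) h2.symm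
  let e₁ : IntersectionAlgebra g h ≃ₐ[K] PowerSeries A ⧸ I ⊔ J :=
    Ideal.quotientEquivAlg _ _ (iteratedEquiv K) hIJ
  let e₂ := DoubleQuot.quotQuotEquivQuotSupₐ K I J
  let e₃ : (AdjoinRoot P ⧸ Ideal.span {AdjoinRoot.mk P H}) ≃ₐ[K]
      (PowerSeries A ⧸ I) ⧸ J.map (Ideal.Quotient.mkₐ K I) :=
    Ideal.quotientEquivAlg _ _ e₀ (by
      rw [Ideal.map_span, Ideal.map_span, Set.image_singleton, Set.image_singleton]
      congr 2
      exact (hε H).symm)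
  let e := (e₁.trans e₂.symm).trans e₃.symm
  have h1 := finrank_quotient_span_singleton (AdjoinRoot.powerBasis' hP.monic).basis hnorm
  have := h1.1
  exact ⟨Module.Finite.equiv e.symm.toLinearEquiv, e.toLinearEquiv.finrank_eq.trans h1.2⟩

end Intersection

/-! ### Polar curves -/

section Polar

open Polynomial

variable {K : Type*} [Field K]

/-- The substitution `t ↦ t ^ n`. -/
abbrev expandHom (n : ℕ) (hn : n ≠ 0) : PowerSeries K →+* PowerSeries K :=
  (PowerSeries.expand n hn : PowerSeries K →ₐ[K] PowerSeries K).toRingHom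

theorem order_eq_order_derivative_add_one [CharZero K] {c : PowerSeries K}
    (hc : PowerSeries.constantCoeff c = 0) :
    c.order = (PowerSeries.derivative K c).order + 1 := by
  by_cases h0 : c = 0
  · simp [h0]
  obtain ⟨n, hn⟩ := ENat.ne_top_iff_exists.mp (PowerSeries.order_eq_top.not.mpr h0)
  obtain ⟨h1, h2⟩ := PowerSeries.order_eq_nat.mp hn.symm
  have hn0 : n ≠ 0 := by
    rintro rfl
    exact h1 (by simpa using hc)
  obtain ⟨k, rfl⟩ := Nat.exists_eq_succ_of_ne_zero hn0
  have : (PowerSeries.derivative K c).order = k := by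
    rw [PowerSeries.order_eq_nat]
    refine ⟨?_, fun i hi => ?_⟩
    · rw [PowerSeries.coeff_derivative]
      exact mul_ne_zero h1 (by exact_mod_cast k.succ_ne_zero)
    · rw [PowerSeries.coeff_derivative, h2 _ (by omega), zero_mul]
  rw [← hn, this]
  rfl

theorem coeff_sum_monomial_derivative (P : (PowerSeries K)[X]) (k : ℕ) :
    (∑ k ∈ P.support, monomial k (PowerSeries.derivative K (P.coeff k))).coeff k =
      PowerSeries.derivative K (P.coeff k) := by
  rw [finsetSum_coeff]
  simp only [coeff_monomial]
  rw [Finset.sum_ite_eq' P.support k, ite_eq_left_iff, notMem_support_iff]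
  intro h
  rw [h, map_zero]

/-- The coefficientwise derivative of a polynomial over `K[[t]]`. -/
def coeffDerivative : (PowerSeries K)[X] →+ (PowerSeries K)[X] where
  toFun P := ∑ k ∈ P.support, monomial k (PowerSeries.derivative K (P.coeff k))
  map_zero' := by simp
  map_add' P Q := by
    ext1 k
    rw [coeff_sum_monomial_derivative, coeff_add, coeff_add, coeff_sum_monomial_derivative,
      coeff_sum_monomial_derivative, map_add]

theorem coeff_coeffDerivative (P : (PowerSeries K)[X]) (k : ℕ) :
    (coeffDerivative P).coeff k = PowerSeries.derivative K (P.coeff k) :=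
  coeff_sum_monomial_derivative P k

theorem coeffDerivative_monomial (k : ℕ) (a : PowerSeries K) :
    coeffDerivative (monomial k a) = monomial k (PowerSeries.derivative K a) := by
  ext1 j
  rw [coeff_coeffDerivative, coeff_monomial, coeff_monomial]
  split_ifs
  · rfl
  · simp

theorem derivative_expandHom (n : ℕ) (hn : n ≠ 0) (a : PowerSeries K) :
    PowerSeries.derivative K (expandHom n hn a) =
      (n : PowerSeries K) * PowerSeries.X ^ (n - 1) *
        expandHom n hn (PowerSeries.derivative K a) := by
  have hs : PowerSeries.HasSubst (PowerSeries.X ^ n : PowerSeries K) :=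
    PowerSeries.HasSubst.X_pow hn
  change PowerSeries.derivative K (PowerSeries.expand n hn a) = _ * PowerSeries.expand n hn _
  rw [PowerSeries.expand_apply, PowerSeries.expand_apply, PowerSeries.derivative_subst hs]
  rw [Derivation.leibniz_pow, PowerSeries.derivative_X]
  simp only [smul_eq_mul, nsmul_eq_mul, mul_one]
  ring

/-- The chain rule for t ↦ P(tⁿ, η(t)). -/
theorem derivative_eval_map_expandHom (n : ℕ) (hn : n ≠ 0) (P : (PowerSeries K)[X])
    (η : PowerSeries K) :
    PowerSeries.derivative K ((P.map (expandHom n hn)).eval η) =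
      (n : PowerSeries K) * PowerSeries.X ^ (n - 1) *
          ((coeffDerivative P).map (expandHom n hn)).eval η +
        ((derivative P).map (expandHom n hn)).eval η * PowerSeries.derivative K η := by
  induction P using Polynomial.induction_on' with
  | add P Q hP hQ =>
    simp only [map_add, Polynomial.map_add, eval_add, hP, hQ]
    ring
  | monomial k a =>
    rw [coeffDerivative_monomial, derivative_monomial]
    simp only [Polynomial.map_monomial, eval_monomial, Derivation.leibniz, derivative_expandHom,
      Derivation.leibniz_pow, smul_eq_mul, nsmul_eq_mul, map_mul, map_natCast]
    ring

theorem order_multisetProd (s : Multiset (PowerSeries K)) :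
    s.prod.order = (s.map PowerSeries.order).sum :=
  map_multiset_prod (PowerSeries.orderHom (R := K)) s

theorem order_natCast_mul [CharZero K] {n : ℕ} (hn : n ≠ 0) (a : PowerSeries K) :
    ((n : PowerSeries K) * a).order = a.order := by
  rw [PowerSeries.order_mul, PowerSeries.order_zero_of_unit, zero_add]
  rw [PowerSeries.isUnit_iff_constantCoeff]
  simpa using hn

/-- On a branch of the polar curve the ∂C/∂y term of the chain rule drops out. The factor n tⁿ⁻¹
accounts for n - 1, and differentiating a series without constant term for the remaining 1. -/
theorem order_eval_of_isRoot [CharZero K] {C : (PowerSeries K)[X]} {n : ℕ} (hn : n ≠ 0)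
    {η : PowerSeries K} (hη : ((derivative C).map (expandHom n hn)).eval η = 0)
    (h0 : PowerSeries.constantCoeff ((C.map (expandHom n hn)).eval η) = 0) :
    ((C.map (expandHom n hn)).eval η).order =
      (((coeffDerivative C).map (expandHom n hn)).eval η).order + n := by
  rw [order_eq_order_derivative_add_one h0, derivative_eval_map_expandHom, hη, zero_mul, add_zero,
    mul_assoc, order_natCast_mul hn, PowerSeries.order_mul, PowerSeries.order_X_pow, add_comm,
    ← add_assoc, add_comm]
  congr 1
  obtain ⟨k, rfl⟩ := Nat.exists_eq_succ_of_ne_zero hn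
  simp [add_comm]

/-- The order of the norm of `∂C/∂x` along the polar curve `∂C/∂y = 0`. -/
theorem order_norm_coeffDerivative [CharZero K] {C P : (PowerSeries K)[X]} {n : ℕ} (hn : n ≠ 0)
    {u : PowerSeries K} (hP : P.Monic) (hCP : derivative C = Polynomial.C u * P)
    (hs : (P.map (expandHom n hn)).Splits)
    (h0 : ∀ η, (P.map (expandHom n hn)).eval η = 0 →
      PowerSeries.constantCoeff ((C.map (expandHom n hn)).eval η) = 0) :
    n • ((Algebra.norm (PowerSeries K)
        (AdjoinRoot.mk P (coeffDerivative C))).order + P.natDegree) =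
      ((P.map (expandHom n hn)).roots.map fun η =>
        ((C.map (expandHom n hn)).eval η).order).sum := by
  have hroots : ∀ η ∈ (P.map (expandHom n hn)).roots, ((C.map (expandHom n hn)).eval η).order =
      (((coeffDerivative C).map (expandHom n hn)).eval η).order + n := by
    intro η hη
    have hη' := isRoot_of_mem_roots hη
    refine order_eval_of_isRoot hn ?_ (h0 η hη')
    rw [hCP, Polynomial.map_mul, eval_mul, hη'.eq_zero, mul_zero]
  rw [Multiset.map_congr rfl hroots, Multiset.sum_map_add, Multiset.map_const',
    Multiset.sum_replicate]
  have hcard : (P.map (expandHom n hn)).roots.card = P.natDegree := by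
    rw [← hs.natDegree_eq_card_roots, hP.natDegree_map]
  have hnorm := congrArg PowerSeries.order (map_norm_adjoinRoot_mk (expandHom n hn) hP hs
    (coeffDerivative C))
  rw [show PowerSeries.order (expandHom n hn _) = _ from PowerSeries.order_expand n hn _] at hnorm
  rw [smul_add, hnorm, hcard, order_multisetProd, Multiset.map_map]
  congr 1
  simp [mul_comm]

/-- Both sides are the double sum of the orders of η - g_j: the intersection number may be read
along either curve. -/
theorem sum_order_eval_roots {Q C : (PowerSeries K)[X]} (hQ : Q.Monic) (hs : Q.Splits) {ι : Type*}
    (s : Finset ι) (g : ι → PowerSeries K) (hC : C = ∏ j ∈ s, (X - Polynomial.C (g j))) :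
    (Q.roots.map fun η => (C.eval η).order).sum = ∑ j ∈ s, (Q.eval (g j)).order := by
  have h1 : ∀ η, (C.eval η).order = ∑ j ∈ s, (η - g j).order := fun η => by
    rw [hC, eval_prod, PowerSeries.order_prod]
    simp
  have h2 : ∀ a, (Q.eval a).order = (Q.roots.map fun η => (η - a).order).sum := fun a => by
    rw [hs.eval_eq_prod_roots_of_monic hQ, order_multisetProd, Multiset.map_map]
    congr 1
    refine Multiset.map_congr rfl fun η _ => ?_
    rw [Function.comp_apply, ← PowerSeries.order_neg, neg_sub]
  simp only [h1, h2]
  exact Multiset.sum_map_sum_map Q.roots s.val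

end Polar

/-! ### The Milnor number of an irreducible curve germ -/

section Milnor

open Polynomial

variable {K : Type*} [Field K]

theorem constantCoeff_comp_expandHom (n : ℕ) (hn : n ≠ 0) :
    (PowerSeries.constantCoeff (R := K)).comp (expandHom n hn) = PowerSeries.constantCoeff :=
  RingHom.ext fun a => PowerSeries.constantCoeff_expand n hn a

theorem order_rescale {c : K} (hc : c ≠ 0) (a : PowerSeries K) :
    (PowerSeries.rescale c a).order = a.order := by
  by_cases h0 : a = 0
  · simp [h0]
  obtain ⟨n, hn⟩ := ENat.ne_top_iff_exists.mp (PowerSeries.order_eq_top.not.mpr h0)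
  obtain ⟨h1, h2⟩ := PowerSeries.order_eq_nat.mp hn.symm
  rw [← hn, PowerSeries.order_eq_nat]
  refine ⟨?_, fun i hi => ?_⟩
  · rw [PowerSeries.coeff_rescale]
    exact mul_ne_zero (pow_ne_zero _ hc) h1
  · rw [PowerSeries.coeff_rescale, h2 i hi, mul_zero]

theorem rescale_comp_expandHom {q : ℕ} (hq : q ≠ 0) {c : K} (hc : c ^ q = 1) :
    (PowerSeries.rescale c).comp (expandHom q hq) = expandHom q hq := by
  ext a n
  change PowerSeries.coeff n (PowerSeries.rescale c (PowerSeries.expand q hq a)) =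
    PowerSeries.coeff n (PowerSeries.expand q hq a)
  rw [PowerSeries.coeff_rescale]
  by_cases h : q ∣ n
  · obtain ⟨k, rfl⟩ := h
    rw [pow_mul, hc, one_pow, one_mul]
  · rw [PowerSeries.coeff_expand_of_not_dvd q hq a h, mul_zero]

variable {q : ℕ} {ζ : K} {G : PowerSeries K} {C P : (PowerSeries K)[X]}

theorem monic_of_map_expandHom (hq : q ≠ 0)
    (hC : C.map (expandHom q hq) =
      ∏ j ∈ Finset.range q, (X - Polynomial.C (PowerSeries.rescale (ζ ^ j) G))) :
    C.Monic ∧ C.natDegree = q := by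
  have hinj : Function.Injective (expandHom (K := K) q hq) := by
    rw [injective_iff_map_eq_zero]
    intro a ha
    ext n
    rw [← PowerSeries.coeff_expand_mul q hq a n]
    exact (congrArg (PowerSeries.coeff (q * n)) ha).trans (by simp)
  constructor
  · refine monic_of_injective hinj ?_
    rw [hC]
    exact monic_prod_of_monic _ _ fun j _ => monic_X_sub_C _
  · rw [← natDegree_map_eq_of_injective hinj, hC,
      natDegree_prod_of_monic _ _ fun j _ => monic_X_sub_C _]
    simp

theorem map_constantCoeff_eq_X_pow (hq : q ≠ 0) (hG : PowerSeries.constantCoeff G = 0)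
    (hC : C.map (expandHom q hq) =
      ∏ j ∈ Finset.range q, (X - Polynomial.C (PowerSeries.rescale (ζ ^ j) G))) :
    C.map PowerSeries.constantCoeff = X ^ q := by
  rw [← constantCoeff_comp_expandHom q hq, ← Polynomial.map_map, hC, Polynomial.map_prod]
  have : ∀ j, PowerSeries.constantCoeff (PowerSeries.rescale (ζ ^ j) G) = 0 := fun j => by
    rw [← PowerSeries.coeff_zero_eq_constantCoeff_apply, PowerSeries.coeff_rescale,
      PowerSeries.coeff_zero_eq_constantCoeff_apply, hG, mul_zero]
  simp [this]

theorem map_constantCoeff_polar_eq_X_pow [CharZero K] (hq : q ≠ 0)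
    (hP : derivative C = Polynomial.C (PowerSeries.C (q : K)) * P)
    (hC : C.map PowerSeries.constantCoeff = X ^ q) :
    P.map PowerSeries.constantCoeff = X ^ (q - 1) := by
  have h := congrArg (Polynomial.map PowerSeries.constantCoeff) hP
  rw [← derivative_map, hC, derivative_X_pow, Polynomial.map_mul, Polynomial.map_C] at h
  have hq' : (q : K) ≠ 0 := by exact_mod_cast hq
  rw [PowerSeries.constantCoeff_C] at h
  exact (mul_left_cancel₀ (C_ne_zero.mpr hq') h).symm

theorem constantCoeff_eval_map_expandHom {n : ℕ} (hn : n ≠ 0) (Q : (PowerSeries K)[X])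
    (η : PowerSeries K) :
    PowerSeries.constantCoeff ((Q.map (expandHom n hn)).eval η) =
      (Q.map PowerSeries.constantCoeff).eval (PowerSeries.constantCoeff η) := by
  rw [← eval_map_apply, Polynomial.map_map, constantCoeff_comp_expandHom]

theorem eval_derivative_prod_X_sub_C {R : Type*} [CommRing R] (q : ℕ) (g : ℕ → R) :
    (derivative (∏ j ∈ Finset.range (q + 1), (X - Polynomial.C (g j)))).eval (g 0) =
      ∏ j ∈ Finset.range q, (g 0 - g (j + 1)) := by
  rw [Finset.prod_range_succ', Polynomial.derivative_mul, eval_add, eval_mul, eval_mul]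
  simp [eval_prod]

/-- The order of the norm of `∂C/∂x` along the polar curve of the germ with
Puiseux roots `G(ζ^j t)`. -/
theorem order_norm_add [IsAlgClosed K] [CharZero K] (hq : q ≠ 0) (hζ : IsPrimitiveRoot ζ q)
    (hG : q = 1 ∨ PowerSeries.constantCoeff G = 0)
    (hC : C.map (expandHom q hq) =
      ∏ j ∈ Finset.range q, (X - Polynomial.C (PowerSeries.rescale (ζ ^ j) G)))
    (hPm : P.Monic) (hP : derivative C = Polynomial.C (PowerSeries.C (q : K)) * P)
    (hdeg : P.natDegree = q - 1) :
    (Algebra.norm (PowerSeries K) (AdjoinRoot.mk P (coeffDerivative C))).order +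
        ((q - 1 : ℕ) : ℕ∞) =
      ∑ j ∈ Finset.range (q - 1), (G - PowerSeries.rescale (ζ ^ (j + 1)) G).order := by
  obtain ⟨m, hm, hs⟩ := splitsAfterExpand (P.map (expandHom q hq)) (hPm.map _)
  have hn : m * q ≠ 0 := mul_ne_zero hm hq
  have hcomp : (expandHom m hm).comp (expandHom q hq) = expandHom (K := K) (m * q) hn :=
    RingHom.ext fun a => (PowerSeries.expand_mul m hm q hq a).symm
  have hs' : (P.map (expandHom (m * q) hn)).Splits := by
    rwa [Polynomial.map_map, hcomp] at hs
  have h0 : ∀ η, (P.map (expandHom (m * q) hn)).eval η = 0 →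
      PowerSeries.constantCoeff ((C.map (expandHom (m * q) hn)).eval η) = 0 := by
    intro η hη
    -- For q = 1 the polar curve is empty, so G need not vanish at the origin; this covers p = 0.
    rcases hG with rfl | hG
    · have : P = 1 := eq_one_of_monic_natDegree_zero hPm hdeg
      simp [this] at hη
    · have hC' := map_constantCoeff_eq_X_pow hq hG hC
      have h := congrArg PowerSeries.constantCoeff hη
      rw [constantCoeff_eval_map_expandHom, map_constantCoeff_polar_eq_X_pow hq hP hC',
        eval_pow, eval_X, map_zero] at h
      rw [constantCoeff_eval_map_expandHom, hC', eval_pow, eval_X, eq_zero_of_pow_eq_zero h,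
        zero_pow hq]
  have h1 := order_norm_coeffDerivative hn hPm hP hs' h0
  rw [sum_order_eval_roots (hPm.map _) hs' (Finset.range q)
    (fun j => expandHom m hm (PowerSeries.rescale (ζ ^ j) G)) (by
      rw [← hcomp, ← Polynomial.map_map, hC, Polynomial.map_prod]
      simp only [Polynomial.map_sub, Polynomial.map_X, Polynomial.map_C])] at h1
  -- The coefficients of P are series in t^q, hence fixed by t ↦ ζ^j t, while the roots of C are
  -- permuted transitively. So all q roots contribute the same order as G.
  have h2 : ∀ j, ((P.map (expandHom (m * q) hn)).eval
      (expandHom m hm (PowerSeries.rescale (ζ ^ j) G))).order =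
      m • ((P.map (expandHom q hq)).eval G).order := by
    intro j
    have hζj : (ζ ^ j) ^ q = 1 := by rw [← pow_mul, mul_comm, pow_mul, hζ.pow_eq_one, one_pow]
    rw [← hcomp, ← Polynomial.map_map, eval_map_apply,
      show (expandHom m hm _).order = _ from PowerSeries.order_expand m hm _]
    conv_lhs => rw [← rescale_comp_expandHom hq hζj, ← Polynomial.map_map, eval_map_apply,
      order_rescale (pow_ne_zero j (hζ.ne_zero hq))]
  have h3 : ((P.map (expandHom q hq)).eval G).order =
      ∑ j ∈ Finset.range (q - 1), (G - PowerSeries.rescale (ζ ^ (j + 1)) G).order := by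
    have h := congrArg (fun Q => eval G (Q.map (expandHom q hq))) hP
    obtain ⟨k, rfl⟩ := Nat.exists_eq_add_one_of_ne_zero hq
    have h4 := eval_derivative_prod_X_sub_C k fun j => PowerSeries.rescale (ζ ^ j) G
    simp only [pow_zero, PowerSeries.rescale_one, RingHom.id_apply] at h4
    simp only [← derivative_map, hC, Polynomial.map_mul, Polynomial.map_C, eval_mul, eval_C] at h
    rw [h4] at h
    rw [Nat.add_sub_cancel, ← PowerSeries.order_prod, h]
    rw [show expandHom (k + 1) hq (PowerSeries.C ((k + 1 : ℕ) : K)) =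
      ((k + 1 : ℕ) : PowerSeries K) by
      simp, order_natCast_mul hq]
  simp only [h2, h3, Finset.sum_const, Finset.card_range, hdeg] at h1
  rw [← mul_smul, mul_comm q m] at h1
  simp only [nsmul_eq_mul] at h1
  -- Orders take values in ℕ∞; the factor mq cancels because it is nonzero and finite.
  have hn' : ((m * q : ℕ) : ℕ∞) ≠ 0 := by exact_mod_cast hn
  exact (ENat.mul_right_strictMono hn' (ENat.natCast_ne_top _)).injective h1

end Milnor

/-! ### The curve germ attached to a connection -/

section Germ

open Polynomial

variable {K : Type*} [Field K]

theorem ofPowerSeries_rescale (c : K) (a : PowerSeries K) :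
    HahnSeries.ofPowerSeries ℤ K (PowerSeries.rescale c a) =
      dilate c (HahnSeries.ofPowerSeries ℤ K a) := by
  ext n
  rw [dilate_coeff]
  rcases lt_or_ge n 0 with hn | hn
  · rw [PowerSeries.coeff_coe, PowerSeries.coeff_coe, if_pos hn, if_pos hn, mul_zero]
  · obtain ⟨k, rfl⟩ := Int.eq_ofNat_of_zero_le hn
    rw [HahnSeries.ofPowerSeries_apply_coeff, HahnSeries.ofPowerSeries_apply_coeff,
      PowerSeries.coeff_rescale, zpow_natCast]

theorem order_ofPowerSeries {a : PowerSeries K} (ha : a ≠ 0) :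
    (HahnSeries.ofPowerSeries ℤ K a).order = a.order.toNat := by
  have ha' : HahnSeries.ofPowerSeries ℤ K a ≠ 0 := by
    rwa [Ne, map_eq_zero_iff _ HahnSeries.ofPowerSeries_injective]
  refine le_antisymm (HahnSeries.order_le_of_coeff_ne_zero ?_) ?_
  · rw [HahnSeries.ofPowerSeries_apply_coeff]
    exact PowerSeries.coeff_order ha
  · rw [HahnSeries.le_order_iff_forall ha']
    intro n hn
    rw [PowerSeries.coeff_coe]
    split_ifs with h
    · rfl
    · exact PowerSeries.coeff_of_lt_order_toNat _ (by omega)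

theorem dilate_ne_zero {c : K} (hc : c ≠ 0) {f : LaurentSeries K} (hf : f ≠ 0) : dilate c f ≠ 0 :=
  (map_ne_zero (dilateHom c hc)).mpr hf

theorem dilate_inv {c : K} (hc : c ≠ 0) (f : LaurentSeries K) :
    dilate c f⁻¹ = (dilate c f)⁻¹ :=
  map_inv₀ (dilateHom c hc) f

theorem order_dilate {c : K} (hc : c ≠ 0) (f : LaurentSeries K) : (dilate c f).order = f.order := by
  by_cases hf : f = 0
  · rw [hf]
    exact congrArg _ (map_zero (dilateHom c hc))
  refine le_antisymm (HahnSeries.order_le_of_coeff_ne_zero ?_) ?_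
  · exact mul_ne_zero (zpow_ne_zero _ hc) (by simpa using hf)
  · rw [HahnSeries.le_order_iff_forall (dilate_ne_zero hc hf)]
    intro n hn
    rw [dilate_coeff, HahnSeries.coeff_eq_zero_of_lt_order hn, mul_zero]

theorem exists_ofPowerSeries_eq_inv {f : LaurentSeries K} (hf : f ≠ 0) {p : ℕ}
    (hord : f.order = -(p : ℤ)) :
    ∃ G : PowerSeries K, HahnSeries.ofPowerSeries ℤ K G = f⁻¹ ∧
      (p ≠ 0 → PowerSeries.constantCoeff G = 0) := by
  have hinv : (f⁻¹).order = p := by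
    have h1 := HahnSeries.order_mul hf (inv_ne_zero hf)
    rw [mul_inv_cancel₀ hf, HahnSeries.order_one] at h1
    omega
  refine ⟨PowerSeries.X ^ p * LaurentSeries.powerSeriesPart f⁻¹, ?_, fun hp => ?_⟩
  · rw [map_mul, HahnSeries.ofPowerSeries_X_pow]
    have := LaurentSeries.single_order_mul_powerSeriesPart f⁻¹
    rwa [hinv] at this
  · simp [hp]

/-- Take orders in -(G - σG) · f · σf = f - σf, where σ is the dilation by c: both f and σf have
order -p, and the right side has negative order, so its order is minus its pole order. -/
theorem order_sub_rescale_add_poleOrder {f : LaurentSeries K} (hf : f ≠ 0) {p : ℕ}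
    (hord : f.order = -(p : ℤ)) {G : PowerSeries K} (hG : HahnSeries.ofPowerSeries ℤ K G = f⁻¹)
    {c : K} (hc : c ≠ 0) (h : ∃ n : ℤ, n < 0 ∧ (f - dilate c f).coeff n ≠ 0) :
    ∃ s : ℕ, (G - PowerSeries.rescale c G).order = s ∧
      s + poleOrder (f - dilate c f) = 2 * p := by
  obtain ⟨n, hn, hne⟩ := h
  have hc0 := dilate_ne_zero hc hf
  have hsub : f - dilate c f ≠ 0 := fun h0 => hne (by rw [h0]; rfl)
  have hlt : (f - dilate c f).order < 0 :=
    (HahnSeries.order_le_of_coeff_ne_zero hne).trans_lt hn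
  have hmul : -(HahnSeries.ofPowerSeries ℤ K (G - PowerSeries.rescale c G)) *
      (f * dilate c f) = f - dilate c f := by
    rw [map_sub, ofPowerSeries_rescale, hG, dilate_inv hc]
    field_simp
    ring
  have hD : G - PowerSeries.rescale c G ≠ 0 := by
    intro h0
    rw [h0, map_zero, neg_zero, zero_mul] at hmul
    exact hsub hmul.symm
  have hD' : -(HahnSeries.ofPowerSeries ℤ K (G - PowerSeries.rescale c G)) ≠ 0 := by
    rwa [neg_ne_zero, Ne, map_eq_zero_iff _ HahnSeries.ofPowerSeries_injective]
  have ho := congrArg HahnSeries.order hmul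
  rw [HahnSeries.order_mul hD' (mul_ne_zero hf hc0), HahnSeries.order_mul hf hc0, order_dilate hc,
    hord, HahnSeries.order_neg, order_ofPowerSeries hD] at ho
  refine ⟨_, (PowerSeries.coe_toNat_order hD).symm, ?_⟩
  unfold poleOrder
  omega

theorem curvePolynomial_eq_prod_range (q : ℕ+) {ζ : K} (hζ : IsPrimitiveRoot ζ (q : ℕ))
    (f : LaurentSeries K) :
    curvePolynomial q ζ f =
      ∏ j ∈ Finset.range q, (X - C (dilate (ζ ^ j) f)⁻¹) := by
  have h1 : ∀ F : ℕ → (LaurentSeries K)[X],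
      ∏ i ∈ Finset.Icc 1 (q : ℕ), F i = ∏ i ∈ Finset.range q, F (i + 1) := by
    intro F
    rw [Finset.range_eq_Ico, Finset.prod_Ico_add' F 0 q 1]
    rfl
  have h2 := Finset.prod_range_succ (fun j : ℕ => (X - C (dilate (ζ ^ j) f)⁻¹)) q
  rw [Finset.prod_range_succ', hζ.pow_eq_one, pow_zero] at h2
  rw [curvePolynomial, h1]
  exact mul_right_cancel₀ (X_sub_C_ne_zero _) h2

/-- The germ `C_{f,q}` as a polynomial in `y` over `K[[x]]`. -/
theorem exists_polynomial_curveGerm (q : ℕ+) {ζ : K} (hζ : IsPrimitiveRoot ζ (q : ℕ))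
    {f : LaurentSeries K} (hf : f ≠ 0) (hord : f.order ≤ 0) {G : PowerSeries K}
    (hG : HahnSeries.ofPowerSeries ℤ K G = f⁻¹) :
    ∃ P : (PowerSeries K)[X],
      P.map (expandHom q q.ne_zero) =
        ∏ j ∈ Finset.range q, (X - C (PowerSeries.rescale (ζ ^ j) G)) ∧
      ∀ e : Fin 2 →₀ ℕ, MvPowerSeries.coeff e (curveGerm q ζ f) =
        PowerSeries.coeff (e 0) (P.coeff (e 1)) := by
  have hζ0 : ζ ≠ 0 := hζ.ne_zero q.ne_zero
  set R : (PowerSeries K)[X] := ∏ j ∈ Finset.range q, (X - C (PowerSeries.rescale (ζ ^ j) G))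
    with hR
  have hmap : curvePolynomial q ζ f = R.map (HahnSeries.ofPowerSeries ℤ K) := by
    simp only [curvePolynomial_eq_prod_range q hζ, hR, Polynomial.map_prod, Polynomial.map_sub,
      Polynomial.map_X, Polynomial.map_C, ofPowerSeries_rescale, hG,
      dilate_inv (pow_ne_zero _ hζ0)]
  have hcoeff : ∀ b n : ℕ, ((curvePolynomial q ζ f).coeff b).coeff (n : ℤ) =
      PowerSeries.coeff n (R.coeff b) := by
    intro b n
    rw [hmap, coeff_map, HahnSeries.ofPowerSeries_apply_coeff]
  -- Only the exponents divisible by q are kept; by `curvePolynomial_coeff` there are no others.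
  let P : (PowerSeries K)[X] := ∑ b ∈ R.support,
    monomial b (PowerSeries.mk fun a => PowerSeries.coeff ((q : ℕ) * a) (R.coeff b))
  have hP : ∀ b, P.coeff b =
      PowerSeries.mk fun a => PowerSeries.coeff ((q : ℕ) * a) (R.coeff b) := by
    intro b
    simp only [P, finsetSum_coeff, coeff_monomial]
    rw [Finset.sum_ite_eq' R.support b, ite_eq_left_iff, notMem_support_iff]
    intro h
    ext a
    simp [h]
  refine ⟨P, ?_, fun e => ?_⟩
  · ext b n
    rw [coeff_map]
    change PowerSeries.coeff n (PowerSeries.expand q q.ne_zero (P.coeff b)) = _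
    by_cases hn : (q : ℕ) ∣ n
    · obtain ⟨a, rfl⟩ := hn
      rw [PowerSeries.coeff_expand_mul, hP, PowerSeries.coeff_mk]
    · rw [PowerSeries.coeff_expand_of_not_dvd _ _ _ hn]
      by_contra hne
      rw [← hcoeff] at hne
      exact hn (by exact_mod_cast (curvePolynomial_coeff q ζ hζ f hf hord b n (Ne.symm hne)).2)
  · rw [hP, PowerSeries.coeff_mk, ← hcoeff]
    push_cast
    rfl

variable {g : MvPowerSeries (Fin 2) K} {C : (PowerSeries K)[X]}

theorem iteratedEquiv_partialX (hg : ∀ e : Fin 2 →₀ ℕ, MvPowerSeries.coeff e g =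
    PowerSeries.coeff (e 0) (C.coeff (e 1))) :
    iteratedEquiv K (partialX g) = (coeffDerivative C : (PowerSeries K)[X]) := by
  ext b a
  rw [coeff_iteratedEquiv, MvPowerSeries.coeff_pderiv, hg, Polynomial.coeff_coe,
    coeff_coeffDerivative, PowerSeries.coeff_derivative]
  simp

theorem iteratedEquiv_partialY (hg : ∀ e : Fin 2 →₀ ℕ, MvPowerSeries.coeff e g =
    PowerSeries.coeff (e 0) (C.coeff (e 1))) :
    iteratedEquiv K (partialY g) = (derivative C : (PowerSeries K)[X]) := by
  ext b a
  rw [coeff_iteratedEquiv, MvPowerSeries.coeff_pderiv, hg, Polynomial.coeff_coe,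
    Polynomial.coeff_derivative,
    show ((b : PowerSeries K) + 1) = PowerSeries.C ((b : K) + 1) by simp, PowerSeries.coeff_mul_C]
  simp

theorem exists_monic_derivative_eq [CharZero K] {q : ℕ} (hq : q ≠ 0) (hC : C.Monic)
    (hdeg : C.natDegree = q) :
    ∃ P : (PowerSeries K)[X], P.Monic ∧ P.natDegree = q - 1 ∧
      derivative C = Polynomial.C (PowerSeries.C (q : K)) * P := by
  have hq' : (q : K) ≠ 0 := by exact_mod_cast hq
  have hcoef : (derivative C).coeff (q - 1) = PowerSeries.C (q : K) := by
    have h1 : q - 1 + 1 = q := Nat.sub_add_cancel (Nat.pos_of_ne_zero hq)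
    have h2 : ((q - 1 : ℕ) : PowerSeries K) + 1 = q := by exact_mod_cast congrArg Nat.cast h1
    rw [Polynomial.coeff_derivative, h1, h2, ← hdeg, hC.coeff_natDegree, one_mul, map_natCast]
  have hCP : derivative C = Polynomial.C (PowerSeries.C (q : K)) *
      (Polynomial.C (PowerSeries.C (q : K)⁻¹) * derivative C) := by
    rw [← mul_assoc, ← Polynomial.C_mul, ← map_mul, mul_inv_cancel₀ hq']
    simp
  have hle : (Polynomial.C (PowerSeries.C (q : K)⁻¹) * derivative C).natDegree ≤ q - 1 := by
    refine (natDegree_C_mul_le _ _).trans ?_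
    rw [← hdeg]
    exact natDegree_derivative_le C
  have h1 : (Polynomial.C (PowerSeries.C (q : K)⁻¹) * derivative C).coeff (q - 1) = 1 := by
    rw [coeff_C_mul, hcoef, ← map_mul, inv_mul_cancel₀ hq', map_one]
  refine ⟨_, monic_of_natDegree_le_of_coeff_eq_one _ hle h1, ?_, hCP⟩
  exact le_antisymm hle (le_natDegree_of_ne_zero (by rw [h1]; exact one_ne_zero))

theorem isDistinguishedAt_of_map_constantCoeff {P : (PowerSeries K)[X]} (hP : P.Monic)
    (h : P.map PowerSeries.constantCoeff = X ^ P.natDegree) :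
    P.IsDistinguishedAt (IsLocalRing.maximalIdeal (PowerSeries K)) := by
  refine ⟨⟨fun {n} hn => ?_⟩, hP⟩
  rw [mem_maximalIdeal_iff]
  have := congrArg (fun Q => Q.coeff n) h
  simpa [coeff_X_pow, hn.ne] using this

end Germ

/-- The Milnor number of `C_{f,q}` in terms of the differences of the conjugates of `f`. -/
theorem milnorNumber_curveGerm {K : Type*} [Field K] [IsAlgClosed K] [CharZero K]
    {q : ℕ+} {p : ℕ} {ζ : K} (hζ : IsPrimitiveRoot ζ (q : ℕ))
    {f : LaurentSeries K} (hf : f ≠ 0) (hord : f.order = -(p : ℤ))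
    (hmin : IsMinimallyRamified q f) :
    Module.Finite K (IntersectionAlgebra (partialX (curveGerm q ζ f))
        (partialY (curveGerm q ζ f))) ∧
      (milnorNumber (curveGerm q ζ f) : ℤ) = (2 * (p : ℤ) - 1) * ((q : ℤ) - 1) -
        ((∑ k ∈ Finset.range q, poleOrder (f - dilate (ζ ^ k) f) : ℕ) : ℤ) := by
  have hζ0 : ζ ≠ 0 := hζ.ne_zero q.ne_zero
  obtain ⟨G, hG, hG0⟩ := exists_ofPowerSeries_eq_inv hf hord
  -- If p = 0, then f - σf has no pole, which minimal ramification excludes unless q = 1.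
  have hq1 : (q : ℕ) = 1 ∨ PowerSeries.constantCoeff G = 0 := by
    refine or_iff_not_imp_left.mpr fun hq => hG0 ?_
    rintro rfl
    have := q.pos
    obtain ⟨n, hn, hne⟩ := exists_coeff_sub_dilate_ne_zero hζ hmin one_pos (by omega)
    apply hne
    rw [HahnSeries.coeff_sub, dilate_coeff, HahnSeries.coeff_eq_zero_of_lt_order (by simpa [hord])]
    simp
  obtain ⟨C, hC, hgerm⟩ := exists_polynomial_curveGerm q hζ hf (by omega) hG
  obtain ⟨hCm, hCdeg⟩ := monic_of_map_expandHom q.ne_zero hC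
  obtain ⟨P, hPm, hPdeg, hP⟩ := exists_monic_derivative_eq q.ne_zero hCm hCdeg
  have hdist : P.IsDistinguishedAt (IsLocalRing.maximalIdeal (PowerSeries K)) := by
    apply isDistinguishedAt_of_map_constantCoeff hPm
    rcases hq1 with h1 | h1
    · rw [h1] at hPdeg
      rw [Polynomial.eq_one_of_monic_natDegree_zero hPm hPdeg]
      simp
    · rw [hPdeg]
      exact map_constantCoeff_polar_eq_X_pow q.ne_zero hP
        (map_constantCoeff_eq_X_pow q.ne_zero h1 hC)
  have hnorm := order_norm_add q.ne_zero hζ hq1 hC hPm hP hPdeg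
  -- Outside the range the value 0 is arbitrary; the condition inside the existential lets s be
  -- chosen as a function on all of ℕ.
  have hs : ∀ j : ℕ, ∃ s : ℕ, j ∈ Finset.range (q - 1) →
      (G - PowerSeries.rescale (ζ ^ (j + 1)) G).order = s ∧
        s + poleOrder (f - dilate (ζ ^ (j + 1)) f) = 2 * p := by
    intro j
    by_cases hj : j ∈ Finset.range (q - 1)
    · obtain ⟨s, hs⟩ := order_sub_rescale_add_poleOrder hf hord hG (pow_ne_zero (j + 1) hζ0)
        (exists_coeff_sub_dilate_ne_zero hζ hmin j.succ_pos (by rw [Finset.mem_range] at hj; omega))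
      exact ⟨s, fun _ => hs⟩
    · exact ⟨0, fun h => absurd h hj⟩
  choose s hs using hs
  rw [Finset.sum_congr rfl fun j hj => (hs j hj).1, ← Nat.cast_sum] at hnorm
  -- The differences G - σ^k G with 0 < k < q are nonzero, so the order of the norm is finite. This
  -- is the finiteness of μ.
  have hnorm0 : Algebra.norm (PowerSeries K) (AdjoinRoot.mk P (coeffDerivative C)) ≠ 0 := by
    intro h0
    rw [h0, PowerSeries.order_zero, top_add] at hnorm
    exact ENat.top_ne_natCast _ hnorm
  have hq' : (q : K) ≠ 0 := by exact_mod_cast q.ne_zero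
  obtain ⟨hfin, hmu⟩ := finrank_intersectionAlgebra hdist hq' (iteratedEquiv_partialX hgerm)
    ((iteratedEquiv_partialY hgerm).trans (by rw [hP])) hnorm0
  refine ⟨hfin, ?_⟩
  rw [← PowerSeries.coe_toNat_order hnorm0, ← hmu] at hnorm
  have hnorm' : milnorNumber (curveGerm q ζ f) + ((q : ℕ) - 1) =
      ∑ j ∈ Finset.range ((q : ℕ) - 1), s j := by exact_mod_cast hnorm
  have hsum : ∑ j ∈ Finset.range ((q : ℕ) - 1), s j +
      ∑ k ∈ Finset.range q, poleOrder (f - dilate (ζ ^ k) f) = ((q : ℕ) - 1) * (2 * p) := by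
    -- The term k = 0 of the irregularity is the pole order of f - f, which is zero; each of the
    -- other q - 1 terms complements s to 2p.
    have h0 : ((q : ℕ) - 1) + 1 = q := Nat.sub_add_cancel q.pos
    rw [← congrArg Finset.range h0, Finset.sum_range_succ', ← add_assoc, ← Finset.sum_add_distrib,
      Finset.sum_congr rfl fun j hj => (hs j hj).2]
    have : dilate (ζ ^ 0) f = f := by
      ext n
      simp [dilate_coeff]
    rw [this, sub_self]
    simp [poleOrder]
  have h1 : (((q : ℕ) - 1 : ℕ) : ℤ) = (q : ℤ) - 1 := by
    have := q.pos
    push_cast [Nat.cast_sub this]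
    rfl
  zify at hnorm' hsum
  rw [h1] at hnorm' hsum
  push_cast
  linarith

end FormalConnection

end

theorem mainTheorem3 {K : Type*} [Field K] [IsAlgClosed K] [CharZero K]
    (q : ℕ+) (p : ℕ) (ζ : K) (hζ : IsPrimitiveRoot ζ (q : ℕ))
    (f : LaurentSeries K) (hf : f ≠ 0) (hord : f.order = -(p : ℤ))
    (hirr : (FormalConnection.connE q f).IsIrreducible) :
    ∃ irr : ℕ,
      (∀ n : ℕ, FormalConnection.HasIrregularity
        ((FormalConnection.connE q f).hom (FormalConnection.connE q f)) n ↔ n = irr) ∧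
      Module.Finite K (FormalConnection.IntersectionAlgebra
        (FormalConnection.partialX (FormalConnection.curveGerm q ζ f))
        (FormalConnection.partialY (FormalConnection.curveGerm q ζ f))) ∧
      (FormalConnection.milnorNumber (FormalConnection.curveGerm q ζ f) : ℤ) =
        (2 * (p : ℤ) - 1) * ((q : ℤ) - 1) - (irr : ℤ) := by
  exact ⟨∑ k ∈ Finset.range q, FormalConnection.poleOrder (f - FormalConnection.dilate (ζ ^ k) f),
    fun n => ⟨fun h => h.unique (FormalConnection.hasIrregularity_hom hζ f),
      fun h => h ▸ FormalConnection.hasIrregularity_hom hζ f⟩,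
    FormalConnection.milnorNumber_curveGerm hζ hf hord
      (FormalConnection.isMinimallyRamified_of_isIrreducible hirr)⟩
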